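/- Let $D=\,]-\tfrac12,\tfrac12[^2$, with the four quadrants $D_1=\,]-\tfrac12,0[^2$, $D_2=\,]0,\tfrac12[\times]-\tfrac12,0[$, $D_3=\,]-\tfrac12,0[\times]0,\tfrac12[$, $D_4=\,]0,\tfrac12[^2$, and let $V=H^1_0(D)$ (real-valued) be normed by $\|v\|_V=\|\nabla v\|_{L^2(D)}$. Let $0<\theta<1$ and $U=[-1,1]^4$. For $f\in V'$ and $y\in U$ let $u(y)\in V$ be the weak solution of $-\operatorname{div}\big(a(\cdot,y)\nabla u(y)\big)=f$ with $a(x,y)=1-\theta\sum_{i=1}^4 y_i\chi_{D_i}(x)$, that is, $$\int_D a(x,y)\,\nabla u(y)\cdot\nabla v\,dx=\langle f,v\rangle\qquad\text{for all } v\in V ,$$ and let $\bar A\colon V\to V'$, $\langle\bar A w,v\rangle=\int_D\nabla w\cdot\nabla v\,dx$. For $k\in\mathbb N=\{0,1,2,\dots\}$ let $u_k(y)=\sum_{|\nu|\le k}t_\nu y^\nu$, $t_\nu=\frac1{\nu!}\partial_\nu u(0)$, be the truncated power series of $u$. (i) For every $f\in V'$ and every $k\in\mathbb N$, with $n(k)=8k+5$,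 there exist $v_1,\dots,v_{n(k)}\in V$ and real polynomials $\phi_1,\dots,\phi_{n(k)}$ in four variables, each of total degree $k$, such that $u_k(y)=\sum_{\ell=1}^{n(k)}\phi_\ell(y)\,v_\ell$ for all $y\in\mathbb R^4$, and $$\sup_{y\in U}\Big\|u(y)-\sum_{\ell=1}^{n(k)}\phi_\ell(y)\,v_\ell\Big\|_V\le\frac{\|\bar A^{-1}f\|_V}{1-\theta}\,\theta^{k+1}.$$ (ii) There is a constant $C$, depending only on $\theta$, such that for every $f\in V'$ and every $n\in\mathbb N$ the Kolmogorov $n$-width of the solution manifold $u(U)=\{u(y):y\in U\}$ satisfies $$d_n\big(u(U)\big)_V:=\inf_{\substack{W\subset V\\ \dim W=n}}\ \sup_{w\in u(U)}\operatorname{dist}_V(w,W)\ \le\ C\,\|\bar A^{-1}f\|_V\,\exp\!\Big(-\frac{|\ln\theta|}{8}\,n\Big).$$ -/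

import Mathlib

open MeasureTheory
open scoped ENNReal NNReal ContDiff Gradient

namespace FourSquares

/-! ### The unit square and its four quadrants -/

/-- The plane with its Euclidean structure. -/
abbrev Plane : Type := EuclideanSpace ℝ (Fin 2)

/-- The open square `D = ]-1/2, 1/2[²`. -/
def square : Set Plane := {x | ∀ j, x j ∈ Set.Ioo (-1 / 2 : ℝ) (1 / 2)}

/-- The four open quadrants `D₁, …, D₄` of the square (indexed by `0, …, 3`). -/
def quadrant : Fin 4 → Set Plane :=
  ![{x | x 0 ∈ Set.Ioo (-1 / 2 : ℝ) 0 ∧ x 1 ∈ Set.Ioo (-1 / 2 : ℝ) 0},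
    {x | x 0 ∈ Set.Ioo (0 : ℝ) (1 / 2) ∧ x 1 ∈ Set.Ioo (-1 / 2 : ℝ) 0},
    {x | x 0 ∈ Set.Ioo (-1 / 2 : ℝ) 0 ∧ x 1 ∈ Set.Ioo (0 : ℝ) (1 / 2)},
    {x | x 0 ∈ Set.Ioo (0 : ℝ) (1 / 2) ∧ x 1 ∈ Set.Ioo (0 : ℝ) (1 / 2)}]

/-- Lebesgue measure on the square. -/
noncomputable abbrev volD : Measure Plane := volume.restrict square

/-! ### The space `H¹₀(D)` -/

/-- Smooth functions with compact support contained in `D`. -/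
def IsTest (φ : Plane → ℝ) : Prop :=
  ContDiff ℝ ∞ φ ∧ HasCompactSupport φ ∧ tsupport φ ⊆ square

lemma IsTest.differentiable {φ : Plane → ℝ} (h : IsTest φ) : Differentiable ℝ φ :=
  h.1.differentiable (by simp)

/-- The pairs `(φ, ∇φ)`, `φ` a test function, as elements of `L²(D) × L²(D; ℝ²)`. -/
noncomputable def testPairs : Submodule ℝ (Lp ℝ 2 volD × Lp Plane 2 volD) where
  carrier := {p | ∃ φ : Plane → ℝ, IsTest φ ∧ p.1 =ᵐ[volD] φ ∧ p.2 =ᵐ[volD] ∇ φ}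
  zero_mem' := by
    refine ⟨0, ⟨contDiff_const, HasCompactSupport.zero, by simp⟩, Lp.coeFn_zero _ _ _, ?_⟩
    have h0 : ∇ (0 : Plane → ℝ) = 0 := by
      funext x; exact gradient_const x 0
    rw [h0]; exact Lp.coeFn_zero _ _ _
  add_mem' := by
    rintro p q ⟨φ, hφ, h1, h2⟩ ⟨ψ, hψ, h3, h4⟩
    refine ⟨φ + ψ, ⟨hφ.1.add hψ.1, hφ.2.1.add hψ.2.1, ?_⟩, ?_, ?_⟩
    · exact (tsupport_add φ ψ).trans (Set.union_subset hφ.2.2 hψ.2.2)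
    · exact (Lp.coeFn_add _ _).trans (h1.add h3)
    · have hg : ∇ (φ + ψ) = ∇ φ + ∇ ψ := by
        funext x
        simp only [gradient, Pi.add_apply]
        rw [fderiv_add (hφ.differentiable x) (hψ.differentiable x), map_add]
      rw [hg]
      exact (Lp.coeFn_add _ _).trans (h2.add h4)
  smul_mem' := by
    rintro c p ⟨φ, hφ, h1, h2⟩
    refine ⟨c • φ, ⟨hφ.1.const_smul c, hφ.2.1.smul_left (f := fun _ => c), ?_⟩, ?_, ?_⟩
    · exact (closure_mono (Function.support_const_smul_subset c φ)).trans hφ.2.2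
    · exact (Lp.coeFn_smul _ _).trans (h1.const_smul c)
    · have hg : ∇ (c • φ) = c • ∇ φ := by
        funext x
        simp only [gradient, Pi.smul_apply]
        rw [fderiv_const_smul (hφ.differentiable x)]
        simp
      rw [hg]
      exact (Lp.coeFn_smul _ _).trans (h2.const_smul c)

/-- The graph `{(v, ∇v) : v ∈ H¹₀(D)}`: the closure of the graph of the gradient on test functions
in `L²(D) × L²(D; ℝ²)`, that is, the closure of the test functions in `H¹(D)`. -/
noncomputable def graphH10 : Submodule ℝ (Lp ℝ 2 volD × Lp Plane 2 volD) := testPairs.topologicalClosure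

/-- The space `V = H¹₀(D)`; its elements are the functions `v`, carried along with their weak
gradient `∇v`. It is normed below by `‖v‖_V = ‖∇v‖_{L²(D)}`. -/
def H10 : Type := ↥graphH10

noncomputable instance : AddCommGroup H10 := inferInstanceAs (AddCommGroup ↥graphH10)
noncomputable instance : Module ℝ H10 := inferInstanceAs (Module ℝ ↥graphH10)

/-- The class in `L²(D)` of an element of `H¹₀(D)`. -/
noncomputable def H10.toL2 : H10 →ₗ[ℝ] Lp ℝ 2 volD :=
  (LinearMap.fst ℝ _ _).comp graphH10.subtype

/-- The weak gradient of an element of `H¹₀(D)`. -/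
noncomputable def H10.grad : H10 →ₗ[ℝ] Lp Plane 2 volD :=
  (LinearMap.snd ℝ _ _).comp graphH10.subtype

lemma square_eq : square = (EuclideanSpace.equiv (Fin 2) ℝ) ⁻¹'
    (Set.univ.pi fun _ => Set.Ioo (-1 / 2 : ℝ) (1 / 2)) := by
  ext x; simp [square]

lemma isOpen_square : IsOpen square := by
  rw [square_eq]
  exact (isOpen_set_pi Set.finite_univ fun _ _ => isOpen_Ioo).preimage
    (EuclideanSpace.equiv (Fin 2) ℝ).continuous

lemma isBounded_square : Bornology.IsBounded square := by
  refine (Metric.isBounded_closedBall (x := (0 : Plane)) (r := 1)).subset fun x hx => ?_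
  rw [mem_closedBall_zero_iff, EuclideanSpace.norm_eq]
  refine Real.sqrt_le_iff.2 ⟨zero_le_one, ?_⟩
  have h0 := hx 0
  have h1 := hx 1
  simp only [Set.mem_Ioo] at h0 h1
  simp only [Fin.sum_univ_two, Real.norm_eq_abs, sq_abs]
  nlinarith

instance : IsFiniteMeasure volD :=
  ⟨by rw [Measure.restrict_apply_univ]; exact isBounded_square.measure_lt_top⟩

/-- The Poincaré inequality on `D`. -/
lemma poincare : ∃ C : ℝ, 0 ≤ C ∧ ∀ v : H10, ‖v.toL2‖ ≤ C * ‖v.grad‖ := by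
  let K : ℝ≥0∞ := eLpNormLESNormFDerivOneConst (volume : Measure Plane) 2 *
    volD Set.univ ^ (1 / (1 : ℝ≥0∞).toReal - 1 / (2 : ℝ≥0∞).toReal)
  have hK : K ≠ ⊤ := by
    refine ENNReal.mul_ne_top ENNReal.coe_ne_top ?_
    exact ENNReal.rpow_ne_top_of_nonneg (by norm_num) (measure_ne_top _ _)
  have hconj : NNReal.HolderConjugate (Module.finrank ℝ Plane : ℝ≥0) 2 := by
    rw [finrank_euclideanSpace_fin]
    exact_mod_cast NNReal.HolderConjugate.two_two
  refine ⟨K.toReal, ENNReal.toReal_nonneg, fun v => ?_⟩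
  have key : (testPairs : Set _) ⊆ {p : Lp ℝ 2 volD × Lp Plane 2 volD |
      ‖p.1‖ ≤ K.toReal * ‖p.2‖} := by
    rintro ⟨u, G⟩ ⟨φ, hφ, h1, h2⟩
    change ‖u‖ ≤ K.toReal * ‖G‖
    set N : Plane → ℝ := fun x => ‖∇ φ x‖ with hN
    have hgn : ∀ x, ‖fderiv ℝ φ x‖ = ‖N x‖ := fun x => by
      rw [hN, norm_norm, ← toDual_gradient, LinearIsometryEquiv.norm_map]
    have hfs : Function.support N ⊆ square := by
      refine subset_trans (fun x hx => ?_) ((support_fderiv_subset ℝ).trans hφ.2.2)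
      intro h0
      exact hx (norm_eq_zero.1 (by rw [← hgn, h0, norm_zero]))
    have hNm : AEStronglyMeasurable N volD := by
      have hc : Continuous fun x => ‖fderiv ℝ φ x‖ := (hφ.1.continuous_fderiv (by simp)).norm
      have hNe : N = fun x => ‖fderiv ℝ φ x‖ := by
        funext x; rw [hgn, hN, norm_norm]
      rw [hNe]; exact hc.aestronglyMeasurable
    have e1 : eLpNorm u 2 volD ≤ eLpNorm φ 2 volume := by
      rw [eLpNorm_congr_ae h1]
      exact eLpNorm_mono_measure _ Measure.restrict_le_self
    have e2 := eLpNorm_le_eLpNorm_fderiv_one (volume : Measure Plane) (hφ.1.of_le (by simp))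
      hφ.2.1 hconj
    have e3 : eLpNorm (fderiv ℝ φ) 1 volume = eLpNorm N 1 volume :=
      eLpNorm_congr_norm_ae (Filter.Eventually.of_forall hgn)
    have e4 : eLpNorm N 1 volD = eLpNorm N 1 volume := eLpNorm_restrict_eq_of_support_subset hfs
    have e5 := eLpNorm_le_eLpNorm_mul_rpow_measure_univ (p := 1) (q := 2) (by norm_num) hNm
    have e6 : eLpNorm N 2 volD = eLpNorm G 2 volD := by
      rw [eLpNorm_congr_ae h2]; exact eLpNorm_norm _
    have hE : eLpNorm u 2 volD ≤ K * eLpNorm G 2 volD := by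
      refine e1.trans (e2.trans ?_)
      rw [e3, ← e4, ← e6]
      simp only [K]
      rw [mul_assoc, mul_comm (volD Set.univ ^ _)]
      exact mul_le_mul_right e5 _
    rw [Lp.norm_def, Lp.norm_def, ← ENNReal.toReal_mul]
    exact ENNReal.toReal_mono (ENNReal.mul_ne_top hK (Lp.eLpNorm_ne_top G)) hE
  have hcl : IsClosed {p : Lp ℝ 2 volD × Lp Plane 2 volD | ‖p.1‖ ≤ K.toReal * ‖p.2‖} :=
    isClosed_le (by fun_prop) (by fun_prop)
  exact closure_minimal key hcl v.2

lemma grad_injective : Function.Injective H10.grad := by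
  rw [injective_iff_map_eq_zero]
  intro v hv
  obtain ⟨C, -, hC⟩ := poincare
  have h1 : v.toL2 = 0 := by
    have := hC v
    rw [hv, norm_zero, mul_zero] at this
    exact norm_le_zero_iff.1 this
  exact Subtype.ext (Prod.ext h1 hv)

/-- The standard norm `‖v‖_V = ‖∇v‖_{L²(D)}` of `H¹₀(D)`. -/
noncomputable instance : NormedAddCommGroup H10 :=
  NormedAddCommGroup.induced H10 (Lp Plane 2 volD) H10.grad grad_injective

/-- The standard inner product `∫_D ∇u · ∇v` of `H¹₀(D)`. -/
noncomputable instance : InnerProductSpace ℝ H10 where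
  inner u v := inner ℝ u.grad v.grad
  norm_smul_le c v := by
    change ‖H10.grad (c • v)‖ ≤ ‖c‖ * ‖H10.grad v‖
    rw [map_smul, norm_smul]
  norm_sq_eq_re_inner v := by
    change ‖H10.grad v‖ ^ 2 = _
    simp
  conj_inner_symm u v := by simp [real_inner_comm]
  add_left u v w := by simp [inner_add_left]
  smul_left u v c := by simp [inner_smul_left]

lemma H10.norm_eq (v : H10) : ‖v‖ = ‖v.grad‖ := rfl

lemma isometry_grad : Isometry H10.grad :=
  AddMonoidHomClass.isometry_of_norm H10.grad fun _ => rfl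

instance : CompleteSpace H10 := by
  obtain ⟨C, hC0, hC⟩ := poincare
  let e : H10 →ₗ[ℝ] ↥graphH10 := LinearMap.id (R := ℝ) (M := ↥graphH10)
  let e' : ↥graphH10 →ₗ[ℝ] H10 := LinearMap.id (R := ℝ) (M := ↥graphH10)
  have : CompleteSpace ↥graphH10 :=
    (Submodule.isClosed_topologicalClosure testPairs).completeSpace_coe
  have he : UniformContinuous e := by
    refine (e.mkContinuous (max C 1) fun v => ?_).uniformContinuous
    change max ‖v.toL2‖ ‖v.grad‖ ≤ max C 1 * ‖v.grad‖
    refine max_le ((hC v).trans ?_) ?_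
    · gcongr; exact le_max_left _ _
    · exact le_mul_of_one_le_left (norm_nonneg _) (le_max_right _ _)
  have he' : UniformContinuous e' := by
    refine (e'.mkContinuous 1 fun v => ?_).uniformContinuous
    rw [one_mul]
    exact le_max_right _ _
  let E : H10 ≃ᵤ ↥graphH10 := ⟨⟨e, e', fun _ => rfl, fun _ => rfl⟩, he, he'⟩
  exact E.completeSpace_iff.2 this

/-! ### The parametric diffusion problem -/

/-- The bilinear form `∫_D a ∇u · ∇v dx`. -/
noncomputable def diffusionForm (a : Plane → ℝ) (u v : H10) : ℝ :=
  ∫ x in square, a x * inner ℝ (u.grad x) (v.grad x)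

/-- `u` is the weak solution in `H¹₀(D)` of `-div (a ∇u) = f`, where `f ∈ V'`. -/
def IsWeakSolution (a : Plane → ℝ) (f : StrongDual ℝ H10) (u : H10) : Prop :=
  ∀ v : H10, diffusionForm a u v = f v

open Classical in
/-- The weak solution in `H¹₀(D)` of `-div (a ∇u) = f`; it exists and is unique for elliptic `a`,
see `existsUnique_weakSolution`. -/
noncomputable def weakSolution (a : Plane → ℝ) (f : StrongDual ℝ H10) : H10 :=
  if h : ∃ u, IsWeakSolution a f u then h.choose else 0

lemma integrable_inner (u v : H10) :
    Integrable (fun x => inner ℝ (u.grad x) (v.grad x)) volD :=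
  L2.integrable_inner u.grad v.grad

lemma integral_inner (u v : H10) : ∫ x in square, inner ℝ (u.grad x) (v.grad x) = inner ℝ u v :=
  (L2.inner_def u.grad v.grad).symm

theorem existsUnique_weakSolution {a : Plane → ℝ} {r R : ℝ} (ha : Measurable a) (hr : 0 < r)
    (h : ∀ x ∈ square, r ≤ a x ∧ a x ≤ R) (f : StrongDual ℝ H10) :
    ∃! u, IsWeakSolution a f u := by
  have hae : ∀ᵐ x ∂volD, r ≤ a x ∧ a x ≤ R := by
    filter_upwards [ae_restrict_mem isOpen_square.measurableSet] with x hx using h x hx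
  have hint : ∀ u v : H10, Integrable (fun x => a x * inner ℝ (u.grad x) (v.grad x)) volD := by
    intro u v
    refine (integrable_inner u v).bdd_mul (c := R) ha.aestronglyMeasurable ?_
    filter_upwards [hae] with x hx
    rw [Real.norm_eq_abs, abs_le]
    constructor <;> linarith [hx.1, hx.2]
  let B₀ : H10 →ₗ[ℝ] H10 →ₗ[ℝ] ℝ := LinearMap.mk₂ ℝ (diffusionForm a)
    (by
      intro u u' v
      simp only [diffusionForm]
      rw [← integral_add (hint u v) (hint u' v)]
      refine integral_congr_ae ?_
      filter_upwards [Lp.coeFn_add u.grad u'.grad] with x hx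
      rw [map_add, hx, Pi.add_apply, inner_add_left, mul_add])
    (by
      intro c u v
      simp only [diffusionForm]
      rw [smul_eq_mul, ← integral_const_mul]
      refine integral_congr_ae ?_
      filter_upwards [Lp.coeFn_smul c u.grad] with x hx
      rw [map_smul, hx, Pi.smul_apply, real_inner_smul_left]; ring)
    (by
      intro v u u'
      simp only [diffusionForm]
      rw [← integral_add (hint v u) (hint v u')]
      refine integral_congr_ae ?_
      filter_upwards [Lp.coeFn_add u.grad u'.grad] with x hx
      rw [map_add, hx, Pi.add_apply, inner_add_right, mul_add])
    (by
      intro c v u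
      simp only [diffusionForm]
      rw [smul_eq_mul, ← integral_const_mul]
      refine integral_congr_ae ?_
      filter_upwards [Lp.coeFn_smul c u.grad] with x hx
      rw [map_smul, hx, Pi.smul_apply, real_inner_smul_right]; ring)
  have hbound : ∀ u v, ‖B₀ u v‖ ≤ R * ‖u‖ * ‖v‖ := by
    intro u v
    have hnn : Integrable (fun x => ‖u.grad x‖ * ‖v.grad x‖) volD :=
      (Lp.memLp u.grad).norm.integrable_mul (Lp.memLp v.grad).norm
    have hHol : ∫ x in square, ‖u.grad x‖ * ‖v.grad x‖ ≤ ‖u‖ * ‖v‖ := by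
      have h1 := integral_mul_norm_le_Lp_mul_Lq (μ := volD) (f := u.grad) (g := v.grad)
        Real.HolderConjugate.two_two (by simpa using Lp.memLp u.grad)
        (by simpa using Lp.memLp v.grad)
      have h2 : ∀ w : H10, (∫ x in square, ‖w.grad x‖ ^ (2 : ℝ)) ^ (1 / (2 : ℝ)) = ‖w‖ := by
        intro w
        have : ∫ x in square, ‖w.grad x‖ ^ (2 : ℝ) = ‖w‖ ^ 2 := by
          rw [← real_inner_self_eq_norm_sq w, ← integral_inner]
          simp
        rw [this, ← Real.sqrt_eq_rpow, Real.sqrt_sq (norm_nonneg _)]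
      rwa [h2, h2] at h1
    calc ‖B₀ u v‖ ≤ ∫ x in square, ‖a x * inner ℝ (u.grad x) (v.grad x)‖ :=
          norm_integral_le_integral_norm _
      _ ≤ ∫ x in square, R * (‖u.grad x‖ * ‖v.grad x‖) := by
          refine integral_mono_ae (hint u v).norm (hnn.const_mul R) ?_
          filter_upwards [hae] with x hx
          rw [norm_mul]
          have h3 : ‖a x‖ ≤ R := by
            rw [Real.norm_eq_abs, abs_le]
            constructor <;> linarith [hx.1, hx.2]
          have h4 := norm_inner_le_norm (𝕜 := ℝ) (u.grad x) (v.grad x)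
          gcongr
          exact (norm_nonneg _).trans h3
      _ = R * ∫ x in square, ‖u.grad x‖ * ‖v.grad x‖ := integral_const_mul _ _
      _ ≤ R * (‖u‖ * ‖v‖) := by
          have hR : 0 ≤ R := by
            have h5 := h 0 (by intro j; constructor <;> norm_num)
            linarith [h5.1, h5.2]
          gcongr
      _ = R * ‖u‖ * ‖v‖ := by ring
  let B : H10 →L[ℝ] H10 →L[ℝ] ℝ := B₀.mkContinuous₂ R hbound
  have hB : ∀ u v, B u v = diffusionForm a u v := fun _ _ => rfl
  have hco : IsCoercive B := by
    refine ⟨r, hr, fun u => ?_⟩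
    rw [hB, mul_assoc, ← real_inner_self_eq_norm_mul_norm, ← integral_inner,
      ← integral_const_mul]
    refine integral_mono_ae ((integrable_inner u u).const_mul r) (hint u u) ?_
    filter_upwards [hae] with x hx
    exact mul_le_mul_of_nonneg_right hx.1 real_inner_self_nonneg
  refine ⟨hco.continuousLinearEquivOfBilin.symm ((InnerProductSpace.toDual ℝ H10).symm f),
    fun v => ?_, fun u hu => ?_⟩
  · rw [← hB, ← hco.continuousLinearEquivOfBilin_apply, ContinuousLinearEquiv.apply_symm_apply,
      InnerProductSpace.toDual_symm_apply]
  · have h6 : hco.continuousLinearEquivOfBilin u = (InnerProductSpace.toDual ℝ H10).symm f := by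
      refine ext_inner_right ℝ fun v => ?_
      rw [hco.continuousLinearEquivOfBilin_apply, InnerProductSpace.toDual_symm_apply, hB]
      exact hu v
    rw [← h6, ContinuousLinearEquiv.symm_apply_apply]

/-- The parameter domain `U = [-1, 1]⁴`. -/
def paramDomain : Set (Fin 4 → ℝ) := Set.Icc (-1) 1

/-- The coefficient `a(x, y) = 1 - ∑ᵢ yᵢ θ χ_{Dᵢ}(x)`. -/
noncomputable def coefficient (θ : ℝ) (y : Fin 4 → ℝ) (x : Plane) : ℝ :=
  1 - ∑ i, y i * (quadrant i).indicator (fun _ => θ) x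

/-- The solution map `y ↦ u(y)`. -/
noncomputable def solution (θ : ℝ) (f : StrongDual ℝ H10) (y : Fin 4 → ℝ) : H10 :=
  weakSolution (coefficient θ y) f

/-- `Ā⁻¹ f`, where `⟨Āu, v⟩ = ∫_D ∇u · ∇v dx`. -/
noncomputable def invAbar (f : StrongDual ℝ H10) : H10 := weakSolution (fun _ => 1) f

lemma measurableSet_quadrant (i : Fin 4) : MeasurableSet (quadrant i) := by
  have h (j : Fin 2) (s t : ℝ) : MeasurableSet {x : Plane | x j ∈ Set.Ioo s t} := by
    have hm : Measurable fun x : Plane => x j := by fun_prop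
    exact hm measurableSet_Ioo
  fin_cases i
  all_goals exact (h 0 _ _).inter (h 1 _ _)

lemma coefficient_bounds {θ : ℝ} (h0 : 0 < θ) {y : Fin 4 → ℝ} (hy : y ∈ paramDomain)
    (x : Plane) : 1 - θ ≤ coefficient θ y x ∧ coefficient θ y x ≤ 1 + θ := by
  have hy' : ∀ i, -1 ≤ y i ∧ y i ≤ 1 := fun i => ⟨hy.1 i, hy.2 i⟩
  have h1 := hy' 0
  have h2 := hy' 1
  have h3 := hy' 2
  have h4 := hy' 3
  simp only [coefficient, Fin.sum_univ_four]
  by_cases c0 : 0 < x 0 <;> by_cases c1 : 0 < x 1 <;>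
    simp [quadrant, Set.indicator, c0, c1, not_lt_of_gt] <;> split_ifs <;> constructor <;>
    nlinarith

/-- For `θ ∈ ]0,1[` and `y ∈ U`, `solution θ f y` is the unique weak solution. -/
theorem isWeakSolution_solution {θ : ℝ} (h0 : 0 < θ) (h1 : θ < 1) (f : StrongDual ℝ H10)
    {y : Fin 4 → ℝ} (hy : y ∈ paramDomain) (u : H10) :
    IsWeakSolution (coefficient θ y) f u ↔ u = solution θ f y := by
  have hm : Measurable (coefficient θ y) := by
    unfold coefficient
    refine measurable_const.sub (Finset.measurable_fun_sum _ fun i _ => ?_)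
    exact (measurable_const.indicator (measurableSet_quadrant i)).const_mul _
  have hex := existsUnique_weakSolution hm (sub_pos.2 h1)
    (fun x _ => coefficient_bounds h0 hy x) f
  have hs : IsWeakSolution (coefficient θ y) f (solution θ f y) := by
    rw [solution, weakSolution, dif_pos hex.exists]
    exact hex.exists.choose_spec
  exact ⟨fun hu => hex.unique hu hs, fun hu => hu ▸ hs⟩

/-- `invAbar f` is the unique `u` with `Āu = f`. -/
theorem isWeakSolution_invAbar (f : StrongDual ℝ H10) (u : H10) :
    IsWeakSolution (fun _ => 1) f u ↔ u = invAbar f := by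
  have hex := existsUnique_weakSolution (a := fun _ => (1 : ℝ)) (r := 1) (R := 1)
    measurable_const one_pos (fun x _ => ⟨le_rfl, le_rfl⟩) f
  have hs : IsWeakSolution (fun _ => 1) f (invAbar f) := by
    rw [invAbar, weakSolution, dif_pos hex.exists]
    exact hex.exists.choose_spec
  exact ⟨fun hu => hex.unique hu hs, fun hu => hu ▸ hs⟩

/-! ### Truncated power series and Kolmogorov widths -/

/-- The partial derivative `∂w/∂yᵢ` of a vector-valued function of `y ∈ ℝ⁴`. -/
noncomputable def partialDeriv (i : Fin 4) (w : (Fin 4 → ℝ) → H10) : (Fin 4 → ℝ) → H10 :=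
  fun y => lineDeriv ℝ w y (Pi.single i 1)

/-- The mixed partial derivative `∂_ν w` for a multi-index `ν`. -/
noncomputable def mixedDeriv (ν : Fin 4 → ℕ) (w : (Fin 4 → ℝ) → H10) : (Fin 4 → ℝ) → H10 :=
  (partialDeriv 0)^[ν 0] ((partialDeriv 1)^[ν 1] ((partialDeriv 2)^[ν 2]
    ((partialDeriv 3)^[ν 3] w)))

/-- The Taylor coefficient `t_ν = (1/ν!) ∂_ν u(0)` of the solution map. -/
noncomputable def taylorCoeff (θ : ℝ) (f : StrongDual ℝ H10) (ν : Fin 4 → ℕ) : H10 :=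
  (∏ i, ((ν i).factorial : ℝ))⁻¹ • mixedDeriv ν (solution θ f) 0

/-- The truncated power series `u_k(y) = ∑_{|ν| ≤ k} t_ν y^ν`. -/
noncomputable def truncatedSeries (θ : ℝ) (f : StrongDual ℝ H10) (k : ℕ) (y : Fin 4 → ℝ) : H10 :=
  ∑ m ∈ Finset.range (k + 1), ∑ ν ∈ Finset.piAntidiag (Finset.univ : Finset (Fin 4)) m,
    (∏ i, y i ^ ν i) • taylorCoeff θ f ν

/-- The Kolmogorov `n`-width `d_n(K)_X = inf_{dim W = n} sup_{v ∈ K} dist(v, W)` of a subset `K` of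
a normed space `X`. -/
noncomputable def kolmogorovWidth {X : Type*} [NormedAddCommGroup X] [NormedSpace ℝ X]
    (K : Set X) (n : ℕ) : ℝ≥0∞ :=
  ⨅ (W : Submodule ℝ X) (_ : Module.rank ℝ W = n), ⨆ v ∈ K, Metric.infEDist v (W : Set X)

end FourSquares

/-! Write g = `invAbar f` and let B(y) = `paramOp θ y` = θ ∑ yᵢ Qᵢ, where Qᵢ = `quadOp i` compresses
multiplication of gradients by χ_{Dᵢ} to H¹₀(D). The weak equation reads u - B(y)u = g, and ‖B(y)‖ ≤
θ on U because |1 - a(·,y)| ≤ θ. Hence u is a Neumann series, its truncation is ∑_{m ≤ k} B(y)^m g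
(`truncatedSeries_eq`), and the remainder B(y)^{k+1} u has norm at most ‖g‖ θ^{k+1}/(1-θ).
Everything rests on showing that the words of length at most k in the Qᵢ, applied to g, span only
8k+5 dimensions instead of a number growing like a power of k.

Each Qᵢ is a combination of the identity, S₀, S₁ and X, the compressions of multiplication by sign
x₀, sign x₁ and sign(x₀x₁) (`signOp`, `crossOp`). A function odd in x_j vanishes on the axis x_j =
0, so its product with sign x_j stays in H¹₀(D) (`signPair_mem`). On such functions S_j is therefore
genuine multiplication, which gives S_j² = 1, S_iS_j = X and XS_j = S_i for i ≠ j.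

Splitting g by parity, and each part into a piece vanishing on both axes and its orthogonal
complement, gives g = s + h + z₀ + z₁ (`exists_decomposition`). On s the quadrants decouple: B(y)
multiplies Qᵢs by θyᵢ, so four vectors suffice. An edge function z (odd in x_j, even in x_i, S_i z =
0) is sent by S_j to a corner function and by X to an edge function of the other orientation; a
corner function h is killed by X and sent by each S_j to an edge function. Consequently words of
length at most k applied to z span at most 2k+1 dimensions (Xⁿz and SXⁿz), and those applied to h at
most 1 + 2(2k-1) = 4k-1 for k ≥ 1. The total is 4 + (4k-1) + 2(2k+1) = 8k+5. The width bound follows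
by choosing k as large as n permits. -/

namespace FourSquares

/-! ### Sign multipliers, reflections and test functions in L²(D). -/

section ReflectionsAndSigns

open Filter Topology

/-! ### Multiplication by the sign of a coordinate -/

/-- The sign of the `j`-th coordinate, as an element of `L^∞(D)`. -/
noncomputable def signLp (j : Fin 2) : Lp ℝ ∞ volD :=
  MemLp.toLp (fun x : Plane => Real.sign (x j)) <| by
    refine MemLp.of_bound (C := 1) ?_ (Eventually.of_forall fun x => ?_)
    · have h1 : Measurable fun x : Plane => x j := by fun_prop
      have h2 : Measurable Real.sign := by
        unfold Real.sign
        exact Measurable.ite measurableSet_Iio measurable_const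
          (Measurable.ite measurableSet_Ioi measurable_const measurable_const)
      exact (h2.comp h1).aestronglyMeasurable
    · rcases Real.sign_apply_eq (x j) with h | h | h <;> rw [h] <;> norm_num

lemma coeFn_signLp (j : Fin 2) : signLp j =ᵐ[volD] fun x => Real.sign (x j) :=
  MemLp.coeFn_toLp _

/-- Multiplication by the sign of the `j`-th coordinate in `L²(D; E)`. -/
noncomputable def signMul {E : Type*} [NormedAddCommGroup E] [NormedSpace ℝ E] (j : Fin 2) :
    Lp E 2 volD →L[ℝ] Lp E 2 volD :=
  (ContinuousLinearMap.lsmul ℝ ℝ : ℝ →L[ℝ] E →L[ℝ] E).holderL volD ∞ 2 2 (signLp j)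

lemma coeFn_signMul {E : Type*} [NormedAddCommGroup E] [NormedSpace ℝ E] (j : Fin 2)
    (G : Lp E 2 volD) : signMul j G =ᵐ[volD] fun x => Real.sign (x j) • G x := by
  have h := ContinuousLinearMap.coeFn_holder (r := 2)
    (ContinuousLinearMap.lsmul ℝ ℝ : ℝ →L[ℝ] E →L[ℝ] E) (signLp j) G
  filter_upwards [h, coeFn_signLp j] with x h1 h2
  rw [← h2]
  exact h1

lemma ae_coord_ne_zero (j : Fin 2) : ∀ᵐ x ∂volD, x j ≠ 0 := by
  refine ae_restrict_of_ae ?_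
  have h := (EuclideanSpace.volume_preserving_symm_measurableEquiv_toLp (Fin 2)).quasiMeasurePreserving
  have h2 : ∀ᵐ z : Fin 2 → ℝ, z j ≠ 0 := Measure.ae_eval_ne (fun _ : Fin 2 => (volume : Measure ℝ)) j 0
  exact h.ae h2

lemma signMul_signMul {E : Type*} [NormedAddCommGroup E] [NormedSpace ℝ E] (j : Fin 2)
    (G : Lp E 2 volD) : signMul j (signMul j G) = G := by
  refine Lp.ext ?_
  filter_upwards [coeFn_signMul j (signMul j G), coeFn_signMul j G, ae_coord_ne_zero j]
    with x h1 h2 h3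
  rw [h1, h2, smul_smul]
  rcases Real.sign_apply_eq_of_ne_zero _ h3 with h | h <;> rw [h] <;> simp

lemma signMul_comm {E : Type*} [NormedAddCommGroup E] [NormedSpace ℝ E] (i j : Fin 2)
    (G : Lp E 2 volD) : signMul i (signMul j G) = signMul j (signMul i G) := by
  refine Lp.ext ?_
  filter_upwards [coeFn_signMul j (signMul i G), coeFn_signMul j G, coeFn_signMul i (signMul j G),
    coeFn_signMul i G] with x h1 h2 h3 h4
  rw [h1, h3, h2, h4, smul_comm]

lemma inner_signMul_left (j : Fin 2) (F G : Lp Plane 2 volD) :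
    inner ℝ (signMul j F) G = inner ℝ F (signMul j G) := by
  rw [L2.inner_def, L2.inner_def]
  refine integral_congr_ae ?_
  filter_upwards [coeFn_signMul j F, coeFn_signMul j G] with x h1 h2
  rw [h1, h2, real_inner_smul_left, real_inner_smul_right]

/-! ### Reflections -/

/-- The reflection of the plane that changes the sign of the `j`-th coordinate. -/
noncomputable def refl (j : Fin 2) : Plane ≃ₗᵢ[ℝ] Plane :=
  LinearIsometryEquiv.piLpCongrRight 2 fun i =>
    if i = j then LinearIsometryEquiv.neg ℝ else LinearIsometryEquiv.refl ℝ ℝ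

lemma refl_apply (j i : Fin 2) (x : Plane) : refl j x i = if i = j then -x i else x i := by
  rw [refl, LinearIsometryEquiv.piLpCongrRight_apply]
  change (if i = j then LinearIsometryEquiv.neg ℝ else LinearIsometryEquiv.refl ℝ ℝ) (x i) = _
  split_ifs <;> simp

lemma refl_refl (j : Fin 2) (x : Plane) : refl j (refl j x) = x := by
  ext i
  rw [refl_apply, refl_apply]
  split_ifs <;> simp

lemma refl_comm (i j : Fin 2) (x : Plane) : refl i (refl j x) = refl j (refl i x) := by
  ext k
  simp only [refl_apply]
  split_ifs <;> simp

lemma inner_refl_left (j : Fin 2) (x y : Plane) : inner ℝ (refl j x) y = inner ℝ x (refl j y) := by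
  rw [← LinearIsometryEquiv.inner_map_map (refl j) x, refl_refl]

lemma refl_preimage_square (j : Fin 2) : refl j ⁻¹' square = square := by
  ext x
  simp only [square, Set.mem_preimage, Set.mem_ofPred_eq, refl_apply, Set.mem_Ioo]
  refine forall_congr' fun i => ?_
  split_ifs
  · constructor <;> rintro ⟨h1, h2⟩ <;> constructor <;> linarith
  · rfl

lemma measurePreserving_refl (j : Fin 2) : MeasurePreserving (refl j) volD volD := by
  have h := (refl j).measurePreserving.restrict_preimage isOpen_square.measurableSet
  rwa [refl_preimage_square] at h

/-- Composition with a reflection in `L²(D)`. -/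
noncomputable def reflFun (j : Fin 2) : Lp ℝ 2 volD →L[ℝ] Lp ℝ 2 volD :=
  (Lp.compMeasurePreservingₗᵢ ℝ (refl j) (measurePreserving_refl j)).toContinuousLinearMap

/-- The action of a reflection on gradient fields in `L²(D; ℝ²)`. -/
noncomputable def reflField (j : Fin 2) : Lp Plane 2 volD →L[ℝ] Lp Plane 2 volD :=
  ((refl j).toContinuousLinearEquiv : Plane →L[ℝ] Plane).compLpL 2 volD ∘L
    (Lp.compMeasurePreservingₗᵢ ℝ (refl j) (measurePreserving_refl j)).toContinuousLinearMap

lemma coeFn_reflFun (j : Fin 2) (u : Lp ℝ 2 volD) :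
    reflFun j u =ᵐ[volD] fun x => u (refl j x) :=
  Lp.coeFn_compMeasurePreserving u (measurePreserving_refl j)

lemma coeFn_reflField (j : Fin 2) (G : Lp Plane 2 volD) :
    reflField j G =ᵐ[volD] fun x => refl j (G (refl j x)) := by
  filter_upwards [ContinuousLinearMap.coeFn_compLpL (p := 2) (μ := volD)
    ((refl j).toContinuousLinearEquiv : Plane →L[ℝ] Plane)
    (Lp.compMeasurePreservingₗᵢ ℝ (refl j) (measurePreserving_refl j) G),
    Lp.coeFn_compMeasurePreserving G (measurePreserving_refl j)] with x h1 h2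
  exact h1.trans (congrArg (refl j) h2)

lemma ae_comp_refl (j : Fin 2) {p : Plane → Prop} (h : ∀ᵐ x ∂volD, p x) :
    ∀ᵐ x ∂volD, p (refl j x) :=
  (measurePreserving_refl j).quasiMeasurePreserving.ae h

lemma reflField_reflField (j : Fin 2) (G : Lp Plane 2 volD) : reflField j (reflField j G) = G := by
  refine Lp.ext ?_
  filter_upwards [coeFn_reflField j (reflField j G), ae_comp_refl j (coeFn_reflField j G)]
    with x h1 h2
  rw [h1, h2, refl_refl, refl_refl]

lemma reflField_comm (i j : Fin 2) (G : Lp Plane 2 volD) :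
    reflField i (reflField j G) = reflField j (reflField i G) := by
  refine Lp.ext ?_
  filter_upwards [coeFn_reflField i (reflField j G), ae_comp_refl i (coeFn_reflField j G),
    coeFn_reflField j (reflField i G), ae_comp_refl j (coeFn_reflField i G)]
    with x h1 h2 h3 h4
  rw [h1, h2, h3, h4, refl_comm, refl_comm i j x]

lemma inner_reflField_left (j : Fin 2) (F G : Lp Plane 2 volD) :
    inner ℝ (reflField j F) G = inner ℝ F (reflField j G) := by
  rw [L2.inner_def, L2.inner_def, ← (measurePreserving_refl j).integral_comp
    (refl j).toHomeomorph.measurableEmbedding]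
  refine integral_congr_ae ?_
  filter_upwards [ae_comp_refl j (coeFn_reflField j F), coeFn_reflField j G] with x h1 h2
  rw [h1, h2, refl_refl, inner_refl_left]

/-- The factor sign x_j is odd under the j-th reflection; this is the source of every change of
parity below. -/
lemma reflField_signMul_self (j : Fin 2) (G : Lp Plane 2 volD) :
    reflField j (signMul j G) = -signMul j (reflField j G) := by
  refine Lp.ext ?_
  filter_upwards [coeFn_reflField j (signMul j G), ae_comp_refl j (coeFn_signMul j G),
    Lp.coeFn_neg (signMul j (reflField j G)), coeFn_signMul j (reflField j G),
    coeFn_reflField j G] with x h1 h2 h3 h4 h5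
  rw [h1, h2, h3, Pi.neg_apply, h4, h5, map_smul, refl_apply, if_pos rfl, Real.sign_neg, neg_smul]

lemma reflField_signMul_of_ne {i j : Fin 2} (hij : i ≠ j) (G : Lp Plane 2 volD) :
    reflField i (signMul j G) = signMul j (reflField i G) := by
  refine Lp.ext ?_
  filter_upwards [coeFn_reflField i (signMul j G), ae_comp_refl i (coeFn_signMul j G),
    coeFn_signMul j (reflField i G), coeFn_reflField i G] with x h1 h2 h4 h5
  rw [h1, h2, h4, h5, map_smul, refl_apply, if_neg hij.symm]

/-! ### Test functions -/

lemma IsTest.continuous_gradient {φ : Plane → ℝ} (h : IsTest φ) : Continuous (∇ φ) :=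
  (InnerProductSpace.toDual ℝ Plane).symm.continuous.comp (h.1.continuous_fderiv (by simp))

lemma IsTest.exists_bound {φ : Plane → ℝ} (h : IsTest φ) :
    ∃ C, 0 ≤ C ∧ (∀ x, ‖φ x‖ ≤ C) ∧ ∀ x, ‖∇ φ x‖ ≤ C := by
  obtain ⟨C, hC⟩ := h.2.1.exists_bound_of_continuous h.1.continuous
  obtain ⟨C', hC'⟩ := (h.2.1.fderiv ℝ).exists_bound_of_continuous (h.1.continuous_fderiv (by simp))
  refine ⟨max C C', (norm_nonneg _).trans ((hC 0).trans (le_max_left _ _)),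
    fun x => (hC x).trans (le_max_left _ _), fun x => ?_⟩
  rw [← LinearIsometryEquiv.norm_map (InnerProductSpace.toDual ℝ Plane), toDual_gradient]
  exact (hC' x).trans (le_max_right _ _)

lemma IsTest.memLp {φ : Plane → ℝ} (h : IsTest φ) : MemLp φ 2 volD := by
  obtain ⟨C, -, hC, -⟩ := h.exists_bound
  exact MemLp.of_bound h.1.continuous.aestronglyMeasurable C (Eventually.of_forall hC)

lemma IsTest.memLp_gradient {φ : Plane → ℝ} (h : IsTest φ) : MemLp (∇ φ) 2 volD := by
  obtain ⟨C, -, -, hC⟩ := h.exists_bound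
  exact MemLp.of_bound h.continuous_gradient.aestronglyMeasurable C (Eventually.of_forall hC)

/-- The element `(φ, ∇φ)` of the graph attached to a test function. -/
noncomputable def IsTest.pair {φ : Plane → ℝ} (h : IsTest φ) : Lp ℝ 2 volD × Lp Plane 2 volD :=
  (h.memLp.toLp φ, h.memLp_gradient.toLp (∇ φ))

lemma IsTest.pair_mem {φ : Plane → ℝ} (h : IsTest φ) : h.pair ∈ testPairs :=
  ⟨φ, h, MemLp.coeFn_toLp h.memLp, MemLp.coeFn_toLp h.memLp_gradient⟩

lemma IsTest.comp_refl {φ : Plane → ℝ} (h : IsTest φ) (j : Fin 2) : IsTest (φ ∘ refl j) := by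
  refine ⟨h.1.comp (refl j).contDiff, h.2.1.comp_homeomorph (refl j).toHomeomorph, ?_⟩
  have h1 : tsupport (φ ∘ refl j) = refl j ⁻¹' tsupport φ :=
    tsupport_comp_eq_preimage φ (refl j).toHomeomorph
  rw [h1, ← refl_preimage_square j]
  exact Set.preimage_mono h.2.2

lemma gradient_comp_refl {φ : Plane → ℝ} (h : Differentiable ℝ φ) (j : Fin 2) (x : Plane) :
    ∇ (φ ∘ refl j) x = refl j (∇ φ (refl j x)) := by
  refine HasGradientAt.gradient ?_
  rw [hasGradientAt_iff_hasFDerivAt]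
  have h1 := (h (refl j x)).hasFDerivAt.comp x
    ((refl j).toContinuousLinearEquiv : Plane →L[ℝ] Plane).hasFDerivAt
  refine h1.congr_fderiv (ContinuousLinearMap.ext fun v => Eq.symm ?_)
  rw [InnerProductSpace.toDual_apply_apply, inner_refl_left, ← InnerProductSpace.toDual_apply_apply,
    toDual_gradient]
  rfl

end ReflectionsAndSigns

/-! ### Multiplying odd functions of H¹₀(D) by the sign of a coordinate. -/

section SignOfOddFunctions

open Filter Topology

/-- A bounded sequence that converges almost everywhere converges in `L²(D)`. -/
lemma tendsto_Lp_of_bounded {E : Type*} [NormedAddCommGroup E] {F : ℕ → Plane → E} {f : Plane → E}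
    {u : ℕ → Lp E 2 volD} {w : Lp E 2 volD} (hu : ∀ n, u n =ᵐ[volD] F n) (hw : w =ᵐ[volD] f)
    {C : ℝ} (hC : ∀ n x, ‖F n x‖ ≤ C)
    (hlim : ∀ᵐ x ∂volD, Tendsto (fun n => F n x) atTop (𝓝 (f x))) :
    Tendsto u atTop (𝓝 w) := by
  rw [Lp.tendsto_Lp_iff_tendsto_eLpNorm']
  have hall : ∀ᵐ x ∂volD, ∀ n, u n x = F n x := ae_all_iff.2 hu
  have hlim' : ∀ᵐ x ∂volD, Tendsto (fun n => u n x) atTop (𝓝 (w x)) := by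
    filter_upwards [hall, hw, hlim] with x h1 h2 h3
    simpa only [h1, h2] using h3
  have hwC : ∀ᵐ x ∂volD, ‖w x‖ ≤ C := by
    filter_upwards [hlim', hall] with x h1 h2
    exact le_of_tendsto h1.norm (Eventually.of_forall fun n => by rw [h2]; exact hC n x)
  have hint : Tendsto (fun n => ∫⁻ x, ‖(u n - w : Plane → E) x‖ₑ ^ (2 : ℝ) ∂volD) atTop
      (𝓝 (∫⁻ _, 0 ∂volD)) := by
    refine tendsto_lintegral_of_dominated_convergence' (fun _ => ENNReal.ofReal (C + C) ^ (2 : ℝ))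
      (fun n => ?_) (fun n => ?_) ?_ ?_
    · exact (((Lp.aestronglyMeasurable (u n)).sub (Lp.aestronglyMeasurable w)).enorm).pow_const _
    · filter_upwards [hall, hwC] with x h1 h2
      refine ENNReal.rpow_le_rpow ?_ (by norm_num)
      rw [← ofReal_norm]
      refine ENNReal.ofReal_le_ofReal ((norm_sub_le _ _).trans (add_le_add ?_ h2))
      rw [h1]
      exact hC n x
    · rw [lintegral_const]
      exact ENNReal.mul_ne_top (ENNReal.rpow_ne_top_of_nonneg (by norm_num) ENNReal.ofReal_ne_top)
        (measure_ne_top _ _)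
    · filter_upwards [hlim'] with x h1
      have h2 : Tendsto (fun n => u n x - w x) atTop (𝓝 0) := by
        simpa using h1.sub_const (w x)
      have h3 := (ENNReal.continuous_rpow_const (y := (2 : ℝ))).tendsto _ |>.comp h2.enorm
      simpa [Function.comp_def] using h3
  rw [lintegral_zero] at hint
  have h4 := (ENNReal.continuous_rpow_const (y := (1 / 2 : ℝ))).tendsto _ |>.comp hint
  rw [ENNReal.zero_rpow_of_pos (by norm_num)] at h4
  refine h4.congr fun n => ?_
  rw [eLpNorm_eq_lintegral_rpow_enorm_toReal (by norm_num) (by norm_num)]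
  simp

/-- A smooth approximation of the sign function. -/
noncomputable def smoothSign (n : ℕ) (t : ℝ) : ℝ := 2 / Real.pi * Real.arctan (n * t)

lemma contDiff_smoothSign (n : ℕ) : ContDiff ℝ ∞ (smoothSign n) :=
  contDiff_const.mul (Real.contDiff_arctan.comp (contDiff_const.mul contDiff_id))

lemma hasDerivAt_smoothSign (n : ℕ) (t : ℝ) :
    HasDerivAt (smoothSign n) (2 / Real.pi * (n / (1 + (n * t) ^ 2))) t := by
  have h := ((hasDerivAt_id t).const_mul (n : ℝ)).arctan.const_mul (2 / Real.pi)
  refine h.congr_deriv ?_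
  simp only [id, mul_one]
  ring

lemma abs_smoothSign_le (n : ℕ) (t : ℝ) : |smoothSign n t| ≤ 1 := by
  have hp := Real.pi_pos
  rw [smoothSign, abs_mul, abs_of_pos (by positivity)]
  have h : |Real.arctan (n * t)| ≤ Real.pi / 2 :=
    abs_le.2 ⟨(Real.neg_pi_div_two_lt_arctan _).le, (Real.arctan_lt_pi_div_two _).le⟩
  calc 2 / Real.pi * |Real.arctan (n * t)| ≤ 2 / Real.pi * (Real.pi / 2) := by gcongr
    _ = 1 := by field_simp

lemma tendsto_smoothSign {t : ℝ} (ht : t ≠ 0) :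
    Tendsto (fun n => smoothSign n t) atTop (𝓝 (Real.sign t)) := by
  have hp := Real.pi_pos
  rcases lt_or_gt_of_ne ht with h | h
  · have h1 : Tendsto (fun n : ℕ => (n : ℝ) * t) atTop atBot :=
      tendsto_natCast_atTop_atTop.atTop_mul_const_of_neg h
    have h2 := ((tendsto_nhds_of_tendsto_nhdsWithin Real.tendsto_arctan_atBot).comp h1).const_mul
      (2 / Real.pi)
    have h3 : 2 / Real.pi * -(Real.pi / 2) = -1 := by field_simp
    rw [Real.sign_of_neg h, ← h3]
    exact h2
  · have h1 : Tendsto (fun n : ℕ => (n : ℝ) * t) atTop atTop :=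
      tendsto_natCast_atTop_atTop.atTop_mul_const h
    have h2 := ((tendsto_nhds_of_tendsto_nhdsWithin Real.tendsto_arctan_atTop).comp h1).const_mul
      (2 / Real.pi)
    have h3 : 2 / Real.pi * (Real.pi / 2) = 1 := by field_simp
    rw [Real.sign_of_pos h, ← h3]
    exact h2

lemma tendsto_deriv_smoothSign {t : ℝ} (ht : t ≠ 0) :
    Tendsto (fun n : ℕ => 2 / Real.pi * (n / (1 + (n * t) ^ 2))) atTop (𝓝 0) := by
  have h0 : Tendsto (fun n : ℕ => (n : ℝ) / (1 + (n * t) ^ 2)) atTop (𝓝 0) := by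
    refine squeeze_zero (fun n => by positivity) (g := fun n : ℕ => (t ^ 2)⁻¹ * (n : ℝ)⁻¹)
      (fun n => ?_) ?_
    · rcases Nat.eq_zero_or_pos n with rfl | hn
      · simp
      · have hn' : (0 : ℝ) < n := by exact_mod_cast hn
        have ht2 : 0 < t ^ 2 := by positivity
        rw [← mul_inv, div_le_iff₀ (by positivity), inv_mul_eq_div, le_div_iff₀ (by positivity)]
        nlinarith
    · simpa using (tendsto_inv_atTop_nhds_zero_nat (𝕜 := ℝ)).const_mul (t ^ 2)⁻¹
  simpa using h0.const_mul (2 / Real.pi)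

/-- The derivative of the approximate sign grows like n at the origin. One factor |t|, supplied
later by oddness, makes it bounded uniformly in n, since n|t| ≤ 1 + (nt)². -/
lemma abs_mul_deriv_smoothSign_le (n : ℕ) (t : ℝ) :
    |t| * |2 / Real.pi * (n / (1 + (n * t) ^ 2))| ≤ 1 := by
  have hp := Real.pi_gt_three
  have h1 : 2 / Real.pi ≤ 1 := by rw [div_le_one (by positivity)]; linarith
  rw [abs_of_nonneg (show 0 ≤ 2 / Real.pi * (n / (1 + (n * t) ^ 2)) by positivity)]
  have h2 : |t| * (n / (1 + (n * t) ^ 2)) ≤ 1 := by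
    rw [mul_div_assoc', div_le_one (by positivity), ← sq_abs, abs_mul, Nat.abs_cast]
    nlinarith [sq_nonneg ((n : ℝ) * |t| - 1), abs_nonneg t, Nat.cast_nonneg (α := ℝ) n]
  calc |t| * (2 / Real.pi * (n / (1 + (n * t) ^ 2)))
      = 2 / Real.pi * (|t| * (n / (1 + (n * t) ^ 2))) := by ring
    _ ≤ 1 * 1 := by gcongr
    _ = 1 := one_mul 1

lemma IsTest.smoothSign_mul {φ : Plane → ℝ} (h : IsTest φ) (j : Fin 2) (n : ℕ) :
    IsTest (fun x => smoothSign n (x j) * φ x) := by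
  refine ⟨((contDiff_smoothSign n).comp (EuclideanSpace.proj j : Plane →L[ℝ] ℝ).contDiff).mul h.1,
    h.2.1.mul_left, (tsupport_mul_subset_right).trans h.2.2⟩

lemma gradient_smoothSign_mul {φ : Plane → ℝ} (h : Differentiable ℝ φ) (j : Fin 2) (n : ℕ)
    (x : Plane) : ∇ (fun x => smoothSign n (x j) * φ x) x = smoothSign n (x j) • ∇ φ x +
      (φ x * (2 / Real.pi * (n / (1 + (n * x j) ^ 2)))) • EuclideanSpace.single j 1 := by
  refine HasGradientAt.gradient ?_
  rw [hasGradientAt_iff_hasFDerivAt]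
  have h1 : HasFDerivAt (fun x : Plane => x j) (EuclideanSpace.proj j : Plane →L[ℝ] ℝ) x :=
    (EuclideanSpace.proj j : Plane →L[ℝ] ℝ).hasFDerivAt
  have h2 := ((hasDerivAt_smoothSign n (x j)).comp_hasFDerivAt x h1).mul (h x).hasFDerivAt
  refine h2.congr_fderiv (ContinuousLinearMap.ext fun v => ?_)
  rw [← toDual_gradient]
  simp [EuclideanSpace.inner_single_left]
  ring

/-- The action of a reflection on pairs of a function and its gradient. -/
noncomputable def reflPair (j : Fin 2) :
    Lp ℝ 2 volD × Lp Plane 2 volD →L[ℝ] Lp ℝ 2 volD × Lp Plane 2 volD :=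
  (reflFun j).prodMap (reflField j)

/-- Multiplication by the sign of a coordinate on pairs of a function and its gradient. -/
noncomputable def signPair (j : Fin 2) :
    Lp ℝ 2 volD × Lp Plane 2 volD →L[ℝ] Lp ℝ 2 volD × Lp Plane 2 volD :=
  (signMul j).prodMap (signMul j)

lemma reflPair_pair {p : Lp ℝ 2 volD × Lp Plane 2 volD} {φ : Plane → ℝ} (h : IsTest φ)
    (h1 : p.1 =ᵐ[volD] φ) (h2 : p.2 =ᵐ[volD] ∇ φ) (j : Fin 2) :
    (reflPair j p).1 =ᵐ[volD] φ ∘ refl j ∧ (reflPair j p).2 =ᵐ[volD] ∇ (φ ∘ refl j) := by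
  constructor
  · filter_upwards [coeFn_reflFun j p.1, ae_comp_refl j h1] with x h3 h4
    exact h3.trans h4
  · filter_upwards [coeFn_reflField j p.2, ae_comp_refl j h2] with x h3 h4
    rw [gradient_comp_refl h.differentiable, ← h4]
    exact h3

lemma reflPair_mem (j : Fin 2) {p : Lp ℝ 2 volD × Lp Plane 2 volD} (hp : p ∈ graphH10) :
    reflPair j p ∈ graphH10 := by
  refine map_mem_closure (reflPair j).continuous hp ?_
  rintro p ⟨φ, hφ, h1, h2⟩
  exact ⟨φ ∘ refl j, hφ.comp_refl j, reflPair_pair hφ h1 h2 j⟩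

/-- The test functions `smoothSign n (x j) * φ x` converge in H¹(D) to sign(x_j) φ by dominated
convergence. The dangerous term of their gradient, φ times the derivative of the approximate sign,
stays bounded because φ vanishes to first order on the axis x_j = 0, and it tends to zero off this
axis. -/
lemma signPair_pair_mem {φ : Plane → ℝ} (h : IsTest φ) {j : Fin 2}
    (hodd : ∀ x, φ (refl j x) = -φ x) {p : Lp ℝ 2 volD × Lp Plane 2 volD}
    (h1 : p.1 =ᵐ[volD] φ) (h2 : p.2 =ᵐ[volD] ∇ φ) : signPair j p ∈ graphH10 := by
  obtain ⟨C, hC0, hC, hC'⟩ := h.exists_bound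
  obtain ⟨K, hK⟩ := h.1.lipschitzWith_of_hasCompactSupport h.2.1 (by simp)
  -- By oddness 2|φ(x)| is the distance between the values of φ at x and at its mirror image, and
  -- these points are 2|x_j| apart.
  have hlip : ∀ x, |φ x| ≤ K * |x j| := by
    intro x
    have h3 := hK.dist_le_mul x (refl j x)
    have h4 : dist x (refl j x) = 2 * |x j| := by
      have h5 : x - refl j x = EuclideanSpace.single j (2 * x j) := by
        ext i
        rw [PiLp.sub_apply, refl_apply, PiLp.single_apply]
        split_ifs with hij
        · subst hij; ring
        · ring
      rw [dist_eq_norm, h5, PiLp.norm_single, Real.norm_eq_abs, abs_mul, abs_two]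
    rw [h4, hodd, Real.dist_eq, sub_neg_eq_add, ← two_mul, abs_mul, abs_two] at h3
    linarith
  have ht := fun n => h.smoothSign_mul j n
  have hmem : ∀ n, (ht n).pair ∈ testPairs := fun n => (ht n).pair_mem
  refine mem_closure_of_tendsto (f := fun n => (ht n).pair) (b := atTop) ?_
    (Eventually.of_forall hmem)
  refine Tendsto.prodMk_nhds ?_ ?_
  · refine tendsto_Lp_of_bounded (F := fun n x => smoothSign n (x j) * φ x)
      (f := fun x => Real.sign (x j) * φ x) (C := C)
      (fun n => MemLp.coeFn_toLp (ht n).memLp) ?_ (fun n x => ?_) ?_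
    · filter_upwards [coeFn_signMul j p.1, h1] with x h3 h4
      rw [← h4]
      exact h3
    · rw [norm_mul]
      exact (mul_le_of_le_one_left (norm_nonneg _) (abs_smoothSign_le n _)).trans (hC x)
    · filter_upwards [ae_coord_ne_zero j] with x hx
      exact (tendsto_smoothSign hx).mul_const _
  · refine tendsto_Lp_of_bounded (F := fun n => ∇ fun x => smoothSign n (x j) * φ x)
      (f := fun x => Real.sign (x j) • ∇ φ x) (C := C + K)
      (fun n => MemLp.coeFn_toLp (ht n).memLp_gradient) ?_ (fun n x => ?_) ?_
    · filter_upwards [coeFn_signMul j p.2, h2] with x h3 h4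
      rw [← h4]
      exact h3
    · rw [gradient_smoothSign_mul h.differentiable]
      refine (norm_add_le _ _).trans (add_le_add ?_ ?_)
      · rw [norm_smul]
        exact (mul_le_of_le_one_left (norm_nonneg _) (abs_smoothSign_le n _)).trans (hC' x)
      · rw [norm_smul, PiLp.norm_single, norm_one, mul_one, norm_mul, Real.norm_eq_abs,
          Real.norm_eq_abs]
        calc |φ x| * |2 / Real.pi * (n / (1 + (n * x j) ^ 2))|
            ≤ (K * |x j|) * |2 / Real.pi * (n / (1 + (n * x j) ^ 2))| := by
              gcongr; exact hlip x
          _ = K * (|x j| * |2 / Real.pi * (n / (1 + (n * x j) ^ 2))|) := by ring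
          _ ≤ K := mul_le_of_le_one_right K.2 (abs_mul_deriv_smoothSign_le n _)
    · filter_upwards [ae_coord_ne_zero j] with x hx
      have h3 : Tendsto (fun n : ℕ => smoothSign n (x j) • ∇ φ x +
          (φ x * (2 / Real.pi * (n / (1 + (n * x j) ^ 2)))) •
            (EuclideanSpace.single j 1 : Plane)) atTop
          (𝓝 (Real.sign (x j) • ∇ φ x + (φ x * 0) • (EuclideanSpace.single j 1 : Plane))) :=
        ((tendsto_smoothSign hx).smul_const _).add
          (((tendsto_deriv_smoothSign hx).const_mul _).smul_const _)
      rw [mul_zero, zero_smul, add_zero] at h3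
      exact h3.congr fun n => (gradient_smoothSign_mul h.differentiable j n x).symm

/-- For `v ∈ H¹₀(D)` odd in the `j`-th coordinate, `sign(x_j) v` is in `H¹₀(D)`. -/
lemma signPair_mem {j : Fin 2} {p : Lp ℝ 2 volD × Lp Plane 2 volD} (hp : p ∈ graphH10)
    (hodd : reflPair j p = -p) : signPair j p ∈ graphH10 := by
  -- `A` is the projection onto the part odd in x_j. It preserves test pairs and fixes p, so p is a
  -- limit of odd test pairs.
  let A : Lp ℝ 2 volD × Lp Plane 2 volD →L[ℝ] Lp ℝ 2 volD × Lp Plane 2 volD :=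
    (1 / 2 : ℝ) • (ContinuousLinearMap.id ℝ _ - reflPair j)
  have hA : ∀ q, A q = (1 / 2 : ℝ) • (q - reflPair j q) := fun q => rfl
  have hAp : A p = p := by
    rw [hA, hodd, sub_neg_eq_add, ← two_smul ℝ p, smul_smul]
    norm_num
  have hcl : IsClosed (graphH10 : Set (Lp ℝ 2 volD × Lp Plane 2 volD)) :=
    Submodule.isClosed_topologicalClosure _
  have key : signPair j (A p) ∈ closure (graphH10 : Set (Lp ℝ 2 volD × Lp Plane 2 volD)) := by
    refine map_mem_closure (f := signPair j ∘ A)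
      ((signPair j).continuous.comp A.continuous) hp ?_
    rintro q hq
    obtain ⟨φ, hφ, h1, h2⟩ := hq
    have hr : reflPair j q ∈ testPairs :=
      ⟨φ ∘ refl j, hφ.comp_refl j, reflPair_pair hφ h1 h2 j⟩
    have hAq : A q ∈ testPairs :=
      testPairs.smul_mem _ (testPairs.sub_mem ⟨φ, hφ, h1, h2⟩ hr)
    obtain ⟨ψ, hψ, h3, h4⟩ := hAq
    have h5 : reflPair j (reflPair j q) = q := by
      refine Prod.ext ?_ (reflField_reflField j q.2)
      refine Lp.ext ?_
      filter_upwards [coeFn_reflFun j (reflFun j q.1), ae_comp_refl j (coeFn_reflFun j q.1)]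
        with x h6 h7
      refine h6.trans (h7.trans ?_)
      rw [refl_refl]
    have hodd' : reflPair j (A q) = -A q := by
      rw [hA, map_smul, map_sub, h5, ← smul_neg, neg_sub]
    -- Oddness of the pair gives oddness of ψ only almost everywhere; continuity extends it to all
    -- of the open square.
    have hψodd : ∀ x ∈ square, ψ (refl j x) = -ψ x := by
      have h8 : (fun x => ψ (refl j x)) =ᵐ[volD] fun x => -ψ x := by
        have h9 := (reflPair_pair hψ h3 h4 j).1
        rw [hodd'] at h9
        filter_upwards [h9, Lp.coeFn_neg (A q).1, h3] with x h10 h11 h12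
        rw [← h12]
        exact h10.symm.trans h11
      have h13 := Measure.eqOn_open_of_ae_eq h8 isOpen_square
        (hψ.1.continuous.comp (refl j).continuous).continuousOn hψ.1.continuous.neg.continuousOn
      exact h13
    refine signPair_pair_mem hψ (fun x => ?_) h3 h4
    by_cases hx : x ∈ square
    · exact hψodd x hx
    · have hx' : refl j x ∉ square := by
        rwa [← Set.mem_preimage, refl_preimage_square]
      rw [image_eq_zero_of_notMem_tsupport fun h => hx (hψ.2.2 h),
        image_eq_zero_of_notMem_tsupport fun h => hx' (hψ.2.2 h), neg_zero]
  rw [hAp, hcl.closure_eq] at key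
  exact key

end SignOfOddFunctions

/-! ### The algebra of the compressed sign operators and the splitting of H¹₀(D). -/

section Operators

/-! ### Operators on `H¹₀(D)` -/

/-- The gradient as a linear isometry of `H¹₀(D)` into `L²(D; ℝ²)`. -/
noncomputable def gradL : H10 →ₗᵢ[ℝ] Lp Plane 2 volD := ⟨H10.grad, fun _ => rfl⟩

/-- The compression `∇* M ∇` to `H¹₀(D)` of an operator `M` on `L²(D; ℝ²)`. -/
noncomputable def compress (M : Lp Plane 2 volD →L[ℝ] Lp Plane 2 volD) : H10 →L[ℝ] H10 :=
  (ContinuousLinearMap.adjoint gradL.toContinuousLinearMap) ∘L M ∘L gradL.toContinuousLinearMap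

lemma inner_compress_left (M : Lp Plane 2 volD →L[ℝ] Lp Plane 2 volD) (v w : H10) :
    inner ℝ (compress M v) w = inner ℝ (M v.grad) w.grad :=
  ContinuousLinearMap.adjoint_inner_left gradL.toContinuousLinearMap w (M v.grad)

/-- The adjoint of the isometry ∇ is a left inverse of it, so nothing is lost in the compression
when M∇v is already a gradient. -/
lemma compress_eq_of_grad_eq {M : Lp Plane 2 volD →L[ℝ] Lp Plane 2 volD} {v w : H10}
    (h : w.grad = M v.grad) : compress M v = w := by
  refine ext_inner_right ℝ fun z => ?_
  rw [inner_compress_left, ← h]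
  rfl

lemma norm_compress_apply_le {M : Lp Plane 2 volD →L[ℝ] Lp Plane 2 volD} {c : ℝ} (hc : 0 ≤ c)
    (hM : ∀ G, ‖M G‖ ≤ c * ‖G‖) (v : H10) : ‖compress M v‖ ≤ c * ‖v‖ := by
  have h : ‖compress M v‖ * ‖compress M v‖ ≤ (c * ‖v‖) * ‖compress M v‖ := by
    rw [← real_inner_self_eq_norm_mul_norm, inner_compress_left]
    exact (real_inner_le_norm _ _).trans (mul_le_mul_of_nonneg_right (hM _) (norm_nonneg _))
  by_contra hlt
  push Not at hlt
  have h0 : 0 < ‖compress M v‖ := (by positivity : 0 ≤ c * ‖v‖).trans_lt hlt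
  exact absurd (le_of_mul_le_mul_right h h0) (not_le.2 hlt)

/-- The operator `v ↦ Ā⁻¹ (-div (sign(x_j) ∇v))`. -/
noncomputable def signOp (j : Fin 2) : H10 →L[ℝ] H10 := compress (signMul j)

/-- The operator `v ↦ Ā⁻¹ (-div (sign(x₀ x₁) ∇v))`. -/
noncomputable def crossOp : H10 →L[ℝ] H10 := compress (signMul 0 ∘L signMul 1)

lemma signMul_zero_one {i j : Fin 2} (hij : i ≠ j) (G : Lp Plane 2 volD) :
    (signMul 0 ∘L signMul 1) G = signMul i (signMul j G) := by
  rw [ContinuousLinearMap.comp_apply]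
  obtain ⟨rfl, rfl⟩ | ⟨rfl, rfl⟩ : (i = 0 ∧ j = 1) ∨ (i = 1 ∧ j = 0) := by omega
  · rfl
  · exact signMul_comm _ _ _

lemma inner_signOp_left (j : Fin 2) (v w : H10) :
    inner ℝ (signOp j v) w = inner ℝ v (signOp j w) := by
  rw [signOp, inner_compress_left, inner_signMul_left, real_inner_comm, ← inner_compress_left,
    real_inner_comm]

lemma inner_crossOp_left (v w : H10) : inner ℝ (crossOp v) w = inner ℝ v (crossOp w) := by
  rw [crossOp, inner_compress_left, signMul_zero_one zero_ne_one, inner_signMul_left,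
    inner_signMul_left, ← signMul_zero_one one_ne_zero, real_inner_comm, ← inner_compress_left,
    real_inner_comm]

/-- The action of a reflection on `H¹₀(D)`. -/
noncomputable def reflOp (j : Fin 2) : H10 →ₗ[ℝ] H10 :=
  LinearMap.restrict (p := graphH10) (q := graphH10)
    (reflPair j : Lp ℝ 2 volD × Lp Plane 2 volD →ₗ[ℝ] Lp ℝ 2 volD × Lp Plane 2 volD)
    (fun _ hp => reflPair_mem j hp)

lemma grad_reflOp (j : Fin 2) (v : H10) : (reflOp j v).grad = reflField j v.grad := rfl

lemma reflOp_reflOp (j : Fin 2) (v : H10) : reflOp j (reflOp j v) = v :=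
  grad_injective (by rw [grad_reflOp, grad_reflOp, reflField_reflField])

lemma reflOp_comm (i j : Fin 2) (v : H10) : reflOp i (reflOp j v) = reflOp j (reflOp i v) :=
  grad_injective (by rw [grad_reflOp, grad_reflOp, grad_reflOp, grad_reflOp, reflField_comm])

lemma inner_reflOp_left (j : Fin 2) (v w : H10) :
    inner ℝ (reflOp j v) w = inner ℝ v (reflOp j w) := inner_reflField_left j v.grad w.grad

/-- Reflections are self-adjoint and act compatibly on gradients, so commutation rules pass from the
multipliers on L² to their compressions by testing against w. -/
lemma reflOp_signOp_self (j : Fin 2) (v : H10) :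
    reflOp j (signOp j v) = -signOp j (reflOp j v) := by
  refine ext_inner_right ℝ fun w => ?_
  rw [inner_reflOp_left, inner_neg_left, signOp, inner_compress_left, inner_compress_left,
    grad_reflOp, grad_reflOp, ← inner_reflField_left, reflField_signMul_self, inner_neg_left]

lemma reflOp_signOp_of_ne {i j : Fin 2} (hij : i ≠ j) (v : H10) :
    reflOp i (signOp j v) = signOp j (reflOp i v) := by
  refine ext_inner_right ℝ fun w => ?_
  rw [inner_reflOp_left, signOp, inner_compress_left, inner_compress_left,
    grad_reflOp, grad_reflOp, ← inner_reflField_left, reflField_signMul_of_ne hij]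

lemma reflOp_crossOp (j : Fin 2) (v : H10) : reflOp j (crossOp v) = -crossOp (reflOp j v) := by
  obtain ⟨i, hij⟩ : ∃ i : Fin 2, i ≠ j := exists_ne j
  refine ext_inner_right ℝ fun w => ?_
  rw [inner_reflOp_left, inner_neg_left, crossOp, inner_compress_left, inner_compress_left,
    grad_reflOp, grad_reflOp, ← inner_reflField_left, signMul_zero_one hij.symm,
    signMul_zero_one hij.symm, reflField_signMul_self, reflField_signMul_of_ne hij.symm,
    inner_neg_left]

/-- Here sign(x_j)∇v is the gradient of sign(x_j)v, which lies in H¹₀(D) by `signPair_mem`, so no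
projection takes place. All the product rules below rest on this. -/
lemma grad_signOp_of_odd {j : Fin 2} {v : H10} (hv : reflOp j v = -v) :
    (signOp j v).grad = signMul j v.grad := by
  have hp : signPair j ((show ↥graphH10 from v) : Lp ℝ 2 volD × Lp Plane 2 volD) ∈ graphH10 :=
    signPair_mem (show ↥graphH10 from v).2 (congrArg Subtype.val hv)
  let w : H10 := (⟨_, hp⟩ : ↥graphH10)
  have hw : w.grad = signMul j v.grad := rfl
  rw [signOp, compress_eq_of_grad_eq hw, hw]

section Odd

variable {i j : Fin 2} {v : H10}

lemma signOp_signOp_of_odd (hv : reflOp j v = -v) : signOp j (signOp j v) = v :=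
  compress_eq_of_grad_eq (by rw [grad_signOp_of_odd hv, signMul_signMul])

/-- Only the inner operator has to be a genuine multiplication; the outer compression then sees the
product of the two signs. Oddness in x_j alone is enough. -/
lemma signOp_signOp_of_ne (hij : i ≠ j) (hv : reflOp j v = -v) :
    signOp i (signOp j v) = crossOp v := by
  refine ext_inner_right ℝ fun w => ?_
  rw [signOp, inner_compress_left, grad_signOp_of_odd hv, crossOp, inner_compress_left,
    signMul_zero_one hij]

lemma crossOp_signOp_of_odd (hij : i ≠ j) (hv : reflOp j v = -v) :
    crossOp (signOp j v) = signOp i v := by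
  refine ext_inner_right ℝ fun w => ?_
  rw [crossOp, inner_compress_left, grad_signOp_of_odd hv, signOp, inner_compress_left,
    signMul_zero_one hij, signMul_signMul]

lemma grad_crossOp_of_odd (hij : i ≠ j) (hi : reflOp i v = -v) (hj : reflOp j v = -v) :
    (crossOp v).grad = (signMul 0 ∘L signMul 1) v.grad := by
  have h : reflOp i (signOp j v) = -signOp j v := by
    rw [reflOp_signOp_of_ne hij, hi, map_neg]
  rw [← signOp_signOp_of_ne hij hj, grad_signOp_of_odd h, grad_signOp_of_odd hj,
    signMul_zero_one hij]

lemma crossOp_crossOp_of_odd (hij : i ≠ j) (hi : reflOp i v = -v) (hj : reflOp j v = -v) :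
    crossOp (crossOp v) = v :=
  compress_eq_of_grad_eq (by
    rw [grad_crossOp_of_odd hij hi hj, signMul_zero_one hij, signMul_zero_one hij.symm,
      signMul_signMul, signMul_signMul])

end Odd

/-! ### The skeleton functions of the four parities -/

/-- Functions odd in `x_j` and even in the other coordinate `x_i`, orthogonal to the functions that
vanish on both axes. -/
structure IsEdge (i j : Fin 2) (z : H10) : Prop where
  odd : reflOp j z = -z
  even : reflOp i z = z
  orthogonal : signOp i z = 0

/-- Functions even in both coordinates, orthogonal to the functions that vanish on both axes. -/
structure IsCorner (h : H10) : Prop where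
  even : ∀ j, reflOp j h = h
  orthogonal : crossOp h = 0

/-- X flips both parities, which exchanges the roles of the coordinates. With κ = S_jXz, which is
odd in x_j, self-adjointness gives ‖κ‖² = ⟨z, XS_jκ⟩ = ⟨z, S_iκ⟩ = ⟨S_iz, κ⟩ = 0. -/
lemma IsEdge.crossOp {i j : Fin 2} (hij : i ≠ j) {z : H10} (hz : IsEdge i j z) :
    IsEdge j i (crossOp z) := by
  have h1 : reflOp i (FourSquares.crossOp z) = -FourSquares.crossOp z := by
    rw [reflOp_crossOp, hz.even]
  have h2 : reflOp j (FourSquares.crossOp z) = FourSquares.crossOp z := by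
    rw [reflOp_crossOp, hz.odd, map_neg, neg_neg]
  refine ⟨h1, h2, ?_⟩
  set κ := signOp j (FourSquares.crossOp z) with hκ
  have h3 : reflOp j κ = -κ := by rw [hκ, reflOp_signOp_self, h2]
  rw [← inner_self_eq_zero (𝕜 := ℝ)]
  nth_rewrite 1 [hκ]
  rw [inner_signOp_left, inner_crossOp_left, crossOp_signOp_of_odd hij h3, ← inner_signOp_left,
    hz.orthogonal, inner_zero_left]

/-- S_j flips the parity in x_j only, and XS_jz = S_iz = 0. -/
lemma IsEdge.isCorner_signOp {i j : Fin 2} (hij : i ≠ j) {z : H10} (hz : IsEdge i j z) :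
    IsCorner (signOp j z) := by
  refine ⟨fun l => ?_, by rw [crossOp_signOp_of_odd hij hz.odd, hz.orthogonal]⟩
  by_cases hl : l = j
  · rw [hl, reflOp_signOp_self, hz.odd, map_neg, neg_neg]
  · obtain rfl : l = i := by omega
    rw [reflOp_signOp_of_ne hij, hz.even]

/-- With κ = S_iS_jh, which is odd in x_i, one has ‖κ‖² = ⟨h, S_jS_iκ⟩ = ⟨h, Xκ⟩ = ⟨Xh, κ⟩ = 0. -/
lemma IsCorner.isEdge_signOp {i j : Fin 2} (hij : i ≠ j) {h : H10} (hh : IsCorner h) :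
    IsEdge i j (signOp j h) := by
  have h1 : reflOp j (signOp j h) = -signOp j h := by rw [reflOp_signOp_self, hh.even]
  have h2 : reflOp i (signOp j h) = signOp j h := by rw [reflOp_signOp_of_ne hij, hh.even]
  refine ⟨h1, h2, ?_⟩
  set κ := signOp i (signOp j h) with hκ
  have h3 : reflOp i κ = -κ := by rw [hκ, reflOp_signOp_self, h2]
  rw [← inner_self_eq_zero (𝕜 := ℝ)]
  nth_rewrite 1 [hκ]
  rw [inner_signOp_left, inner_signOp_left, signOp_signOp_of_ne hij.symm h3, ← inner_crossOp_left,
    hh.orthogonal, inner_zero_left]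

/-! ### The operators attached to the quadrants -/

/-- The signs of the two coordinates on the quadrants. -/
def quadSign : Fin 4 → Fin 2 → ℝ := ![![-1, -1], ![1, -1], ![-1, 1], ![1, 1]]

/-- Multiplication by the indicator function of a quadrant in `L²(D; ℝ²)`. -/
noncomputable def quadMul (i : Fin 4) : Lp Plane 2 volD →L[ℝ] Lp Plane 2 volD :=
  (1 / 4 : ℝ) • (ContinuousLinearMap.id ℝ _ + quadSign i 0 • signMul 0 + quadSign i 1 • signMul 1 +
    (quadSign i 0 * quadSign i 1) • (signMul 0 ∘L signMul 1))

lemma quadMul_apply (i : Fin 4) (G : Lp Plane 2 volD) :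
    quadMul i G = (1 / 4 : ℝ) • (G + quadSign i 0 • signMul 0 G + quadSign i 1 • signMul 1 G +
      (quadSign i 0 * quadSign i 1) • signMul 0 (signMul 1 G)) := rfl

lemma indicator_quadrant_eq {x : Plane} (hx : x ∈ square) (h0 : x 0 ≠ 0) (h1 : x 1 ≠ 0)
    (i : Fin 4) : (quadrant i).indicator (fun _ => (1 : ℝ)) x =
      1 / 4 * (1 + quadSign i 0 * Real.sign (x 0)) * (1 + quadSign i 1 * Real.sign (x 1)) := by
  have hx0 := hx 0
  have hx1 := hx 1
  simp only [Set.mem_Ioo] at hx0 hx1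
  rcases lt_or_gt_of_ne h0 with c0 | c0 <;> rcases lt_or_gt_of_ne h1 with c1 | c1 <;>
    fin_cases i <;>
    simp [quadrant, quadSign, Set.indicator, c0, c1, hx0, hx1, Real.sign_of_neg, Real.sign_of_pos,
      not_lt_of_gt] <;> norm_num <;> simp only [hx0, hx1, and_self]

lemma coeFn_quadMul (i : Fin 4) (G : Lp Plane 2 volD) :
    quadMul i G =ᵐ[volD] fun x => (quadrant i).indicator (fun _ => (1 : ℝ)) x • G x := by
  rw [quadMul_apply]
  filter_upwards [Lp.coeFn_smul (1 / 4 : ℝ) (G + quadSign i 0 • signMul 0 G +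
      quadSign i 1 • signMul 1 G + (quadSign i 0 * quadSign i 1) • signMul 0 (signMul 1 G)),
    Lp.coeFn_add (G + quadSign i 0 • signMul 0 G + quadSign i 1 • signMul 1 G)
      ((quadSign i 0 * quadSign i 1) • signMul 0 (signMul 1 G)),
    Lp.coeFn_add (G + quadSign i 0 • signMul 0 G) (quadSign i 1 • signMul 1 G),
    Lp.coeFn_add G (quadSign i 0 • signMul 0 G),
    Lp.coeFn_smul (quadSign i 0) (signMul 0 G), Lp.coeFn_smul (quadSign i 1) (signMul 1 G),
    Lp.coeFn_smul (quadSign i 0 * quadSign i 1) (signMul 0 (signMul 1 G)),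
    coeFn_signMul 0 G, coeFn_signMul 1 G, coeFn_signMul 0 (signMul 1 G), ae_coord_ne_zero 0,
    ae_coord_ne_zero 1, ae_restrict_mem isOpen_square.measurableSet]
    with x h1 h2 h3 h4 h5 h6 h7 h8 h9 h10 h11 h12 h13
  rw [h1, Pi.smul_apply, h2, Pi.add_apply, h3, Pi.add_apply, h4, Pi.add_apply, h5, h6, h7,
    Pi.smul_apply, Pi.smul_apply, Pi.smul_apply, h10, h8, h9, indicator_quadrant_eq h13 h11 h12]
  module

/-- The operator `v ↦ Ā⁻¹ (-div (χ_{D_i} ∇v))`. -/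
noncomputable def quadOp (i : Fin 4) : H10 →L[ℝ] H10 := compress (quadMul i)

lemma quadOp_apply (i : Fin 4) (v : H10) :
    quadOp i v = (1 / 4 : ℝ) • (v + quadSign i 0 • signOp 0 v + quadSign i 1 • signOp 1 v +
      (quadSign i 0 * quadSign i 1) • crossOp v) := by
  refine ext_inner_right ℝ fun w => ?_
  simp only [quadOp, signOp, crossOp, inner_compress_left, quadMul_apply, inner_smul_left,
    inner_add_left, ContinuousLinearMap.comp_apply]
  rfl

lemma sum_quadOp (v : H10) : ∑ i, quadOp i v = v := by
  simp only [quadOp_apply, Fin.sum_univ_four, quadSign, Matrix.cons_val]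
  module

lemma quadMul_quadMul (i j : Fin 4) (G : Lp Plane 2 volD) :
    quadMul j (quadMul i G) = if i = j then quadMul i G else 0 := by
  refine Lp.ext ?_
  have h0 : ∀ᵐ x ∂volD, ((if i = j then quadMul i G else 0 : Lp Plane 2 volD) : Plane → Plane) x =
      if i = j then quadMul i G x else 0 := by
    split_ifs
    · exact Filter.Eventually.of_forall fun _ => rfl
    · exact Lp.coeFn_zero _ _ _
  filter_upwards [coeFn_quadMul j (quadMul i G), coeFn_quadMul i G, h0, ae_coord_ne_zero 0,
    ae_coord_ne_zero 1, ae_restrict_mem isOpen_square.measurableSet] with x h1 h2 h3 h4 h5 h6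
  rw [h1, h3, h2]
  split_ifs with hij
  · subst hij
    rw [smul_smul]
    congr 1
    by_cases hx : x ∈ quadrant i <;> simp [hx]
  -- Distinct quadrants have opposite signs in some coordinate, and there the product of the
  -- indicators contains (1 + sσ)(1 - sσ) = 1 - s²σ² = 0.
  · have hz : quadSign j 0 = -quadSign i 0 ∨ quadSign j 1 = -quadSign i 1 := by
      fin_cases i <;> fin_cases j <;> simp [quadSign] at hij ⊢
    have hs : ∀ l, quadSign i l ^ 2 = 1 := by
      intro l
      fin_cases i <;> fin_cases l <;> simp [quadSign]
    have ht : ∀ t : ℝ, t ≠ 0 → Real.sign t ^ 2 = 1 := by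
      intro t ht
      rcases Real.sign_apply_eq_of_ne_zero t ht with h | h <;> rw [h] <;> norm_num
    have h7 := ht _ h4
    have h8 := ht _ h5
    rw [smul_smul, indicator_quadrant_eq h6 h4 h5, indicator_quadrant_eq h6 h4 h5]
    convert zero_smul ℝ _
    rcases hz with hz | hz <;> rw [hz]
    · linear_combination -(1 / 4 * (1 + quadSign j 1 * Real.sign (x 1)) * (1 / 4) *
        (1 + quadSign i 1 * Real.sign (x 1))) * (Real.sign (x 0) ^ 2 * hs 0 + h7)
    · linear_combination -(1 / 4 * (1 + quadSign j 0 * Real.sign (x 0)) * (1 / 4) *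
        (1 + quadSign i 0 * Real.sign (x 0))) * (Real.sign (x 1) ^ 2 * hs 1 + h8)

lemma quadOp_quadOp_of_grad {i : Fin 4} {v : H10} (h : (quadOp i v).grad = quadMul i v.grad)
    (j : Fin 4) : quadOp j (quadOp i v) = if i = j then quadOp i v else 0 := by
  refine compress_eq_of_grad_eq ?_
  rw [h, quadMul_quadMul]
  split_ifs
  · exact h
  · exact map_zero _

lemma quadMul_mem_range {G : Lp Plane 2 volD} (h : G ∈ LinearMap.range H10.grad)
    (h0 : signMul 0 G ∈ LinearMap.range H10.grad) (h1 : signMul 1 G ∈ LinearMap.range H10.grad)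
    (h2 : signMul 0 (signMul 1 G) ∈ LinearMap.range H10.grad) (i : Fin 4) :
    quadMul i G ∈ LinearMap.range H10.grad := by
  rw [quadMul_apply]
  exact Submodule.smul_mem _ _ (Submodule.add_mem _ (Submodule.add_mem _ (Submodule.add_mem _ h
    (Submodule.smul_mem _ _ h0)) (Submodule.smul_mem _ _ h1)) (Submodule.smul_mem _ _ h2))

/-- Functions that are odd in both coordinates can be multiplied by the signs of the coordinates
and the indicator functions of the quadrants. -/
lemma quadMul_mem_range_of_odd {κ : H10} (hκ : ∀ j, reflOp j κ = -κ) (i : Fin 4) :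
    quadMul i κ.grad ∈ LinearMap.range H10.grad ∧
    (∀ j, quadMul i (signOp j κ).grad ∈ LinearMap.range H10.grad) ∧
    quadMul i (crossOp κ).grad ∈ LinearMap.range H10.grad := by
  have e : κ.grad ∈ LinearMap.range H10.grad := ⟨κ, rfl⟩
  have e0 : signMul 0 κ.grad ∈ LinearMap.range H10.grad := ⟨_, grad_signOp_of_odd (hκ 0)⟩
  have e1 : signMul 1 κ.grad ∈ LinearMap.range H10.grad := ⟨_, grad_signOp_of_odd (hκ 1)⟩
  have e2 : signMul 0 (signMul 1 κ.grad) ∈ LinearMap.range H10.grad :=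
    ⟨_, grad_crossOp_of_odd zero_ne_one (hκ 0) (hκ 1)⟩
  have c := fun G : Lp Plane 2 volD => signMul_comm 1 0 G
  -- The two sign multiplications merely permute the four fields ∇κ, sign(x₀)∇κ, sign(x₁)∇κ and
  -- sign(x₀x₁)∇κ, so the same four memberships serve in every case.
  refine ⟨quadMul_mem_range e e0 e1 e2 i, fun j => ?_, ?_⟩
  · rw [grad_signOp_of_odd (hκ j)]
    fin_cases j
    · refine quadMul_mem_range e0 ?_ ?_ ?_ i <;> simp [*, signMul_signMul]
    · refine quadMul_mem_range e1 ?_ ?_ ?_ i <;> simp [*, signMul_signMul]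
  · rw [grad_crossOp_of_odd zero_ne_one (hκ 0) (hκ 1), ContinuousLinearMap.comp_apply]
    refine quadMul_mem_range e2 ?_ ?_ ?_ i <;> simp [*, signMul_signMul]

lemma reflOp_signOp_of_parity {i j : Fin 2} (hij : i ≠ j) {g : H10} (hj : reflOp j g = -g)
    (hi : reflOp i g = g) (l : Fin 2) : reflOp l (signOp i g) = -signOp i g := by
  by_cases hl : l = i
  · rw [hl, reflOp_signOp_self, hi]
  · obtain rfl : l = j := by omega
    rw [reflOp_signOp_of_ne hij.symm, hj, map_neg]

/-- S_ig is odd in both coordinates, where S_i² = 1; hence S_i³g = S_ig. On this parity class S_i²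
is the projection onto the functions vanishing on both axes, and the difference is the complementary
part. -/
lemma isEdge_sub {i j : Fin 2} (hij : i ≠ j) {g : H10} (hj : reflOp j g = -g)
    (hi : reflOp i g = g) : IsEdge i j (g - signOp i (signOp i g)) := by
  have h := reflOp_signOp_of_parity hij hj hi
  refine ⟨?_, ?_, ?_⟩
  · rw [map_sub, reflOp_signOp_of_ne hij.symm, h, hj, map_neg]
    abel
  · rw [map_sub, reflOp_signOp_self, h, hi, map_neg, neg_neg]
  · rw [map_sub, signOp_signOp_of_odd (h i), sub_self]

lemma isCorner_sub {g : H10} (hg : ∀ j, reflOp j g = g) : IsCorner (g - crossOp (crossOp g)) := by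
  have h : ∀ j, reflOp j (crossOp g) = -crossOp g := fun j => by rw [reflOp_crossOp, hg]
  refine ⟨fun j => ?_, ?_⟩
  · rw [map_sub, reflOp_crossOp, h, hg, map_neg, neg_neg]
  · rw [map_sub, crossOp_crossOp_of_odd zero_ne_one (h 0) (h 1), sub_self]

/-- The decomposition of `H¹₀(D)` into functions on the quadrants and functions determined by their
restrictions to the axes. -/
lemma exists_decomposition (g : H10) : ∃ s h z₀ z₁ : H10, g = s + h + z₀ + z₁ ∧
    (∀ i, (quadOp i s).grad = quadMul i s.grad) ∧ IsCorner h ∧ IsEdge 1 0 z₀ ∧ IsEdge 0 1 z₁ := by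
  have hr := reflOp_reflOp
  have hc := reflOp_comm 1 0
  -- The four parity components: a is even in both coordinates, b odd in x₀ only, c odd in x₁ only,
  -- d odd in both. The last vanishes on both axes and contributes no skeleton function.
  set a := (1 / 4 : ℝ) • (g + reflOp 0 g + reflOp 1 g + reflOp 0 (reflOp 1 g)) with ha
  set b := (1 / 4 : ℝ) • (g - reflOp 0 g + reflOp 1 g - reflOp 0 (reflOp 1 g)) with hb
  set c := (1 / 4 : ℝ) • (g + reflOp 0 g - reflOp 1 g - reflOp 0 (reflOp 1 g)) with hc'
  set d := (1 / 4 : ℝ) • (g - reflOp 0 g - reflOp 1 g + reflOp 0 (reflOp 1 g)) with hd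
  have a0 : ∀ j, reflOp j a = a := by
    intro j
    fin_cases j <;> simp [ha, hr, hc] <;> module
  have b0 : reflOp 0 b = -b := by simp [hb, hr]; module
  have b1 : reflOp 1 b = b := by simp [hb, hr, hc]; module
  have c0 : reflOp 0 c = c := by simp [hc', hr]; module
  have c1 : reflOp 1 c = -c := by simp [hc', hr, hc]; module
  have d0 : ∀ j, reflOp j d = -d := by
    intro j
    fin_cases j <;> simp [hd, hr, hc] <;> module
  have ka := fun j => (reflOp_crossOp j a).trans (by rw [a0 j])
  have kb := reflOp_signOp_of_parity one_ne_zero b0 b1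
  have kc := reflOp_signOp_of_parity zero_ne_one c1 c0
  refine ⟨d + crossOp (crossOp a) + signOp 1 (signOp 1 b) + signOp 0 (signOp 0 c),
    a - crossOp (crossOp a), b - signOp 1 (signOp 1 b), c - signOp 0 (signOp 0 c), ?_, fun i => ?_,
    isCorner_sub a0, isEdge_sub one_ne_zero b0 b1, isEdge_sub zero_ne_one c1 c0⟩
  · rw [ha, hb, hc', hd]
    module
  · have hmem : quadMul i (d + crossOp (crossOp a) + signOp 1 (signOp 1 b) +
        signOp 0 (signOp 0 c)).grad ∈ LinearMap.range H10.grad := by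
      simp only [map_add]
      exact Submodule.add_mem _ (Submodule.add_mem _ (Submodule.add_mem _
        (quadMul_mem_range_of_odd d0 i).1 (quadMul_mem_range_of_odd ka i).2.2)
        ((quadMul_mem_range_of_odd kb i).2.1 1)) ((quadMul_mem_range_of_odd kc i).2.1 0)
    obtain ⟨w, hw⟩ := hmem
    rw [quadOp, compress_eq_of_grad_eq hw, hw]

end Operators

/-! ### Counting dimensions, and polynomial representations of the Neumann sums. -/

section Spans

/-! ### Spans of the words in the operators -/

/-- The span of the alternating words of length at most `k` applied to an edge function. -/
noncomputable def edgeSpan (z : H10) (k : ℕ) : Submodule ℝ H10 :=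
  Submodule.span ℝ ((fun n => (crossOp ^ n) z) '' Finset.range (k + 1)) ⊔
    Submodule.span ℝ ((fun n => signOp 0 ((crossOp ^ n) z) + signOp 1 ((crossOp ^ n) z)) ''
      Finset.range k)

/-- The span of the alternating words of length at most `k` applied to a corner function. -/
noncomputable def cornerSpan (h : H10) : ℕ → Submodule ℝ H10
  | 0 => Submodule.span ℝ {h}
  | k + 1 => Submodule.span ℝ {h} ⊔ edgeSpan (signOp 0 h) k ⊔ edgeSpan (signOp 1 h) k

lemma pow_mem_edgeSpan (z : H10) {n k : ℕ} (h : n ≤ k) : (crossOp ^ n) z ∈ edgeSpan z k :=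
  Submodule.mem_sup_left (Submodule.subset_span ⟨n, by simpa [Nat.lt_succ_iff] using h, rfl⟩)

lemma add_mem_edgeSpan (z : H10) {n k : ℕ} (h : n < k) :
    signOp 0 ((crossOp ^ n) z) + signOp 1 ((crossOp ^ n) z) ∈ edgeSpan z k :=
  Submodule.mem_sup_right (Submodule.subset_span ⟨n, by simpa using h, rfl⟩)

lemma self_mem_edgeSpan (z : H10) (k : ℕ) : z ∈ edgeSpan z k := by
  simpa using pow_mem_edgeSpan z (Nat.zero_le k)

lemma edgeSpan_mono (z : H10) : Monotone (edgeSpan z) := by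
  intro k l hkl
  refine sup_le_sup (Submodule.span_mono (Set.image_mono ?_))
    (Submodule.span_mono (Set.image_mono ?_)) <;>
  · simp only [Finset.coe_range]
    exact Set.Iio_subset_Iio (by omega)

lemma IsEdge.crossOp_pow {i j : Fin 2} (hij : i ≠ j) {z : H10} (hz : IsEdge i j z) (n : ℕ) :
    ∃ i' j', i' ≠ j' ∧ IsEdge i' j' ((FourSquares.crossOp ^ n) z) := by
  induction n with
  | zero => exact ⟨i, j, hij, hz⟩
  | succ n ih =>
    obtain ⟨i', j', h, hn⟩ := ih
    exact ⟨j', i', h.symm, by rw [pow_succ']; exact hn.crossOp h⟩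

/-- One of the two operators kills an edge function. The sum thus denotes the surviving one without
naming the odd coordinate, which alternates along the powers of X. -/
lemma IsEdge.signOp_add {i j : Fin 2} (hij : i ≠ j) {z : H10} (hz : IsEdge i j z) :
    signOp 0 z + signOp 1 z = signOp j z := by
  obtain ⟨rfl, rfl⟩ | ⟨rfl, rfl⟩ : (i = 0 ∧ j = 1) ∨ (i = 1 ∧ j = 0) := by omega
  · rw [hz.orthogonal, zero_add]
  · rw [hz.orthogonal, add_zero]

lemma edgeSpan_induction {i j : Fin 2} (hij : i ≠ j) {z : H10} (hz : IsEdge i j z) {k : ℕ}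
    {L : Submodule ℝ H10} {A : H10 →L[ℝ] H10}
    (h1 : ∀ n i' j', n ≤ k → i' ≠ j' → IsEdge i' j' ((crossOp ^ n) z) → A ((crossOp ^ n) z) ∈ L)
    (h2 : ∀ n i' j', n < k → i' ≠ j' → IsEdge i' j' ((crossOp ^ n) z) →
      A (signOp j' ((crossOp ^ n) z)) ∈ L) {v : H10} (hv : v ∈ edgeSpan z k) : A v ∈ L := by
  have key : edgeSpan z k ≤ L.comap (A : H10 →ₗ[ℝ] H10) := by
    refine sup_le (Submodule.span_le.2 ?_) (Submodule.span_le.2 ?_)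
    · rintro _ ⟨n, hn, rfl⟩
      obtain ⟨i', j', h, he⟩ := hz.crossOp_pow hij n
      have hn' : n < k + 1 := by simpa using hn
      exact h1 n i' j' (by omega) h he
    · rintro _ ⟨n, hn, rfl⟩
      obtain ⟨i', j', h, he⟩ := hz.crossOp_pow hij n
      change A (_ + _) ∈ L
      rw [he.signOp_add h]
      exact h2 n i' j' (by simpa using hn) h he
  exact key hv

lemma crossOp_mem_edgeSpan {i j : Fin 2} (hij : i ≠ j) {z : H10} (hz : IsEdge i j z) {k : ℕ}
    {v : H10} (hv : v ∈ edgeSpan z k) : crossOp v ∈ edgeSpan z (k + 1) := by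
  refine edgeSpan_induction hij hz (fun n i' j' hn h he => ?_) (fun n i' j' hn h he => ?_) hv
  · rw [← mul_apply_eq_comp, ← pow_succ']
    exact pow_mem_edgeSpan z (by omega)
  · rw [(he.isCorner_signOp h).orthogonal]
    exact Submodule.zero_mem _

/-- With e = Xⁿz of odd coordinate j' and even coordinate i': S_{i'}e = 0, S_{j'}e is a generator of
the second kind, S_{j'}S_{j'}e = e and S_{i'}S_{j'}e = Xe. No other vectors arise. -/
lemma signOp_mem_edgeSpan {i j : Fin 2} (hij : i ≠ j) {z : H10} (hz : IsEdge i j z) {k : ℕ}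
    {v : H10} (hv : v ∈ edgeSpan z k) (l : Fin 2) : signOp l v ∈ edgeSpan z (k + 1) := by
  refine edgeSpan_induction hij hz (fun n i' j' hn h he => ?_) (fun n i' j' hn h he => ?_) hv
  · by_cases hl : l = j'
    · rw [hl, ← he.signOp_add h]
      exact add_mem_edgeSpan z (by omega)
    · obtain rfl : l = i' := by omega
      rw [he.orthogonal]
      exact Submodule.zero_mem _
  · by_cases hl : l = j'
    · rw [hl, signOp_signOp_of_odd he.odd]
      exact pow_mem_edgeSpan z (by omega)
    · obtain rfl : l = i' := by omega
      rw [signOp_signOp_of_ne h he.odd, ← mul_apply_eq_comp, ← pow_succ']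
      exact pow_mem_edgeSpan z (by omega)

lemma quadOp_mem {L L' : Submodule ℝ H10} (h : L ≤ L') {v : H10} (hv : v ∈ L)
    (hs : ∀ j, signOp j v ∈ L') (hc : crossOp v ∈ L') (i : Fin 4) : quadOp i v ∈ L' := by
  rw [quadOp_apply]
  exact Submodule.smul_mem _ _ (Submodule.add_mem _ (Submodule.add_mem _ (Submodule.add_mem _ (h hv)
    (Submodule.smul_mem _ _ (hs 0))) (Submodule.smul_mem _ _ (hs 1))) (Submodule.smul_mem _ _ hc))

lemma quadOp_mem_edgeSpan {i j : Fin 2} (hij : i ≠ j) {z : H10} (hz : IsEdge i j z) {k : ℕ}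
    {v : H10} (hv : v ∈ edgeSpan z k) (l : Fin 4) : quadOp l v ∈ edgeSpan z (k + 1) :=
  quadOp_mem (edgeSpan_mono z k.le_succ) hv (signOp_mem_edgeSpan hij hz hv)
    (crossOp_mem_edgeSpan hij hz hv) l

lemma cornerSpan_le_succ (h : H10) (k : ℕ) : cornerSpan h k ≤ cornerSpan h (k + 1) := by
  cases k with
  | zero => exact le_sup_left.trans le_sup_left
  | succ k =>
    exact sup_le_sup (sup_le_sup le_rfl (edgeSpan_mono _ k.le_succ)) (edgeSpan_mono _ k.le_succ)

lemma cornerSpan_mono (h : H10) : Monotone (cornerSpan h) :=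
  monotone_nat_of_le_succ (cornerSpan_le_succ h)

lemma edgeSpan_le_cornerSpan (h : H10) (k : ℕ) (j : Fin 2) :
    edgeSpan (signOp j h) k ≤ cornerSpan h (k + 1) := by
  fin_cases j
  · exact le_sup_right.trans le_sup_left
  · exact le_sup_right

lemma self_mem_cornerSpan (h : H10) (k : ℕ) : h ∈ cornerSpan h k :=
  cornerSpan_mono h (Nat.zero_le k) (Submodule.mem_span_singleton_self h)

lemma IsCorner.quadOp_self_mem {h : H10} (hh : IsCorner h) (k : ℕ) (l : Fin 4) :
    quadOp l h ∈ cornerSpan h (k + 1) := by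
  refine quadOp_mem le_rfl (self_mem_cornerSpan h _) (fun j => ?_) ?_ l
  · exact edgeSpan_le_cornerSpan h k j (self_mem_edgeSpan _ k)
  · rw [hh.orthogonal]
    exact Submodule.zero_mem _

/-- Since Xh = 0, a word can leave h only through the edge functions S₀h and S₁h, after which the
edge spans are stable up to one more letter. -/
lemma quadOp_mem_cornerSpan {h : H10} (hh : IsCorner h) {k : ℕ} {v : H10}
    (hv : v ∈ cornerSpan h k) (l : Fin 4) : quadOp l v ∈ cornerSpan h (k + 1) := by
  have h0 : ∀ k, Submodule.span ℝ {h} ≤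
      (cornerSpan h (k + 1)).comap (quadOp l : H10 →ₗ[ℝ] H10) := fun k => by
    rw [Submodule.span_singleton_le_iff_mem]
    exact hh.quadOp_self_mem k l
  cases k with
  | zero => exact h0 0 hv
  | succ k =>
    have h1 : ∀ {i j : Fin 2} (_ : i ≠ j), edgeSpan (signOp j h) k ≤
        (cornerSpan h (k + 1 + 1)).comap (quadOp l : H10 →ₗ[ℝ] H10) := fun hij w hw =>
      edgeSpan_le_cornerSpan h (k + 1) _ (quadOp_mem_edgeSpan hij (hh.isEdge_signOp hij) hw l)
    exact sup_le (sup_le (h0 _) (h1 one_ne_zero)) (h1 zero_ne_one) hv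

instance (F : ℕ → H10) (k : ℕ) :
    FiniteDimensional ℝ (Submodule.span ℝ (F '' (Finset.range k : Set ℕ))) :=
  FiniteDimensional.span_of_finite ℝ ((Finset.range k).finite_toSet.image F)

instance (z : H10) (k : ℕ) : FiniteDimensional ℝ (edgeSpan z k) := by
  unfold edgeSpan
  infer_instance

lemma finrank_span_image_range_le (F : ℕ → H10) (k : ℕ) :
    Module.finrank ℝ (Submodule.span ℝ (F '' Finset.range k)) ≤ k := by
  classical
  rw [← Finset.coe_image]
  exact (finrank_span_finset_le_card _).trans (Finset.card_image_le.trans (Finset.card_range k).le)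

lemma finrank_edgeSpan_le (z : H10) (k : ℕ) : Module.finrank ℝ (edgeSpan z k) ≤ 2 * k + 1 := by
  have h := Submodule.finrank_add_le_finrank_add_finrank
    (Submodule.span ℝ ((fun n => (crossOp ^ n) z) '' (Finset.range (k + 1) : Set ℕ)))
    (Submodule.span ℝ ((fun n => signOp 0 ((crossOp ^ n) z) + signOp 1 ((crossOp ^ n) z)) ''
      (Finset.range k : Set ℕ)))
  have h1 := finrank_span_image_range_le (fun n => (crossOp ^ n) z) (k + 1)
  have h2 := finrank_span_image_range_le
    (fun n => signOp 0 ((crossOp ^ n) z) + signOp 1 ((crossOp ^ n) z)) k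
  rw [edgeSpan]
  omega

instance (h : H10) (k : ℕ) : FiniteDimensional ℝ (cornerSpan h k) := by
  cases k with
  | zero => exact inferInstanceAs (FiniteDimensional ℝ (Submodule.span ℝ {h}))
  | succ k => exact inferInstanceAs (FiniteDimensional ℝ
      (Submodule.span ℝ {h} ⊔ edgeSpan (signOp 0 h) k ⊔ edgeSpan (signOp 1 h) k :
        Submodule ℝ H10))

/-- The count is 1 + 2(2k+1), that is 4K - 1 with K = k + 1. The formula 4K - 1 fails at K = 0
unless h = 0, hence the shifted index. -/
lemma finrank_cornerSpan_succ_le (h : H10) (k : ℕ) :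
    Module.finrank ℝ (cornerSpan h (k + 1)) ≤ 4 * k + 3 := by
  have h1 := Submodule.finrank_add_le_finrank_add_finrank
    (Submodule.span ℝ {h} ⊔ edgeSpan (signOp 0 h) k) (edgeSpan (signOp 1 h) k)
  have h2 := Submodule.finrank_add_le_finrank_add_finrank
    (Submodule.span ℝ {h}) (edgeSpan (signOp 0 h) k)
  have h3 : Module.finrank ℝ (Submodule.span ℝ {h}) ≤ 1 := by
    simpa using finrank_span_le_card (R := ℝ) ({h} : Set H10)
  have h4 := finrank_edgeSpan_le (signOp 0 h) k
  have h5 := finrank_edgeSpan_le (signOp 1 h) k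
  rw [cornerSpan]
  omega

/-! ### Polynomials with values in a subspace -/

open MvPolynomial in
/-- The polynomial functions of degree at most `k` in four variables with values in `L`. -/
noncomputable def polyFun (k : ℕ) (L : Submodule ℝ H10) : Submodule ℝ ((Fin 4 → ℝ) → H10) :=
  Submodule.span ℝ {F | ∃ (φ : MvPolynomial (Fin 4) ℝ) (v : H10), φ.totalDegree ≤ k ∧ v ∈ L ∧
    F = fun y => eval y φ • v}

lemma polyFun_mono {k k' : ℕ} (hk : k ≤ k') {L L' : Submodule ℝ H10} (hL : L ≤ L') :
    polyFun k L ≤ polyFun k' L' := by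
  refine Submodule.span_mono ?_
  rintro _ ⟨φ, v, h1, h2, rfl⟩
  exact ⟨φ, v, h1.trans hk, hL h2, rfl⟩

/-- The operator `v ↦ Ā⁻¹ (-div ((1 - a(·, y)) ∇v))`. -/
noncomputable def paramOp (θ : ℝ) (y : Fin 4 → ℝ) : H10 →L[ℝ] H10 :=
  ∑ i, (y i * θ) • quadOp i

lemma paramOp_apply (θ : ℝ) (y : Fin 4 → ℝ) (v : H10) :
    paramOp θ y v = ∑ i, (y i * θ) • quadOp i v := by
  simp [paramOp]

open MvPolynomial in
lemma paramOp_mem_polyFun (θ : ℝ) {k : ℕ} {L L' : Submodule ℝ H10}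
    (h : ∀ v ∈ L, ∀ i, quadOp i v ∈ L') {F : (Fin 4 → ℝ) → H10} (hF : F ∈ polyFun k L) :
    (fun y => paramOp θ y (F y)) ∈ polyFun (k + 1) L' := by
  induction hF using Submodule.span_induction with
  | mem F hF =>
    obtain ⟨φ, v, h1, h2, rfl⟩ := hF
    have h3 : (fun y => paramOp θ y (eval y φ • v)) =
        ∑ i, fun y => eval y (X i * C θ * φ) • quadOp i v := by
      funext y
      simp only [paramOp_apply, Finset.sum_apply, map_smul, Finset.smul_sum, smul_smul, map_mul, eval_X,
        eval_C, mul_comm]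
    rw [h3]
    refine Submodule.sum_mem _ fun i _ => Submodule.subset_span ⟨_, _, ?_, h v h2 i, rfl⟩
    have h4 : (X i * C θ : MvPolynomial (Fin 4) ℝ).totalDegree ≤ 1 :=
      (totalDegree_mul _ _).trans (by simp)
    have h5 := totalDegree_mul (X i * C θ) φ
    omega
  | zero =>
    convert Submodule.zero_mem _
    simp
  | add F G _ _ h1 h2 =>
    convert Submodule.add_mem _ h1 h2
    simp
  | smul c F _ h1 =>
    convert Submodule.smul_mem _ c h1
    simp

lemma paramOp_pow_mem_polyFun (θ : ℝ) {L : ℕ → Submodule ℝ H10}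
    (h : ∀ k, ∀ v ∈ L k, ∀ i, quadOp i v ∈ L (k + 1)) {v : H10} (hv : v ∈ L 0) (k : ℕ) :
    (fun y => (paramOp θ y ^ k) v) ∈ polyFun k (L k) := by
  induction k with
  | zero => exact Submodule.subset_span ⟨1, v, by simp, hv, by simp⟩
  | succ k ih =>
    have h1 := paramOp_mem_polyFun θ (h k) ih
    simp only [pow_succ']
    exact h1

lemma sum_paramOp_pow_mem_polyFun (θ : ℝ) {L : ℕ → Submodule ℝ H10} (hL : Monotone L)
    (h : ∀ k, ∀ v ∈ L k, ∀ i, quadOp i v ∈ L (k + 1)) {v : H10} (hv : v ∈ L 0) (k : ℕ) :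
    (fun y => ∑ m ∈ Finset.range (k + 1), (paramOp θ y ^ m) v) ∈ polyFun k (L k) := by
  have h1 : (fun y => ∑ m ∈ Finset.range (k + 1), (paramOp θ y ^ m) v) =
      ∑ m ∈ Finset.range (k + 1), fun y => (paramOp θ y ^ m) v := by
    funext y
    simp
  rw [h1]
  refine Submodule.sum_mem _ fun m hm => ?_
  have hm' : m ≤ k := by simpa [Nat.lt_succ_iff] using hm
  exact polyFun_mono hm' (hL hm') (paramOp_pow_mem_polyFun θ h hv m)

open MvPolynomial in
lemma exists_of_mem_polyFun {ι : Type*} [Fintype ι] (v : ι → H10) {k : ℕ}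
    {F : (Fin 4 → ℝ) → H10} (hF : F ∈ polyFun k (Submodule.span ℝ (Set.range v))) :
    ∃ φ : ι → MvPolynomial (Fin 4) ℝ, (∀ l, (φ l).totalDegree ≤ k) ∧
      ∀ y, F y = ∑ l, eval y (φ l) • v l := by
  induction hF using Submodule.span_induction with
  | mem F hF =>
    obtain ⟨φ, w, h1, h2, rfl⟩ := hF
    obtain ⟨c, rfl⟩ := (Submodule.mem_span_range_iff_exists_fun ℝ).1 h2
    refine ⟨fun l => C (c l) * φ, fun l => ?_, fun y => ?_⟩
    · have h3 := totalDegree_mul (C (c l)) φ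
      rw [totalDegree_C, zero_add] at h3
      exact h3.trans h1
    · beta_reduce
      rw [Finset.smul_sum]
      refine Finset.sum_congr rfl fun l _ => ?_
      rw [map_mul, eval_C, smul_smul, mul_comm]
  | zero => exact ⟨0, by simp, by simp⟩
  | add F G _ _ h1 h2 =>
    obtain ⟨φ, h3, h4⟩ := h1
    obtain ⟨ψ, h5, h6⟩ := h2
    exact ⟨φ + ψ, fun l => (totalDegree_add _ _).trans (max_le (h3 l) (h5 l)), fun y => by
      simp [h4, h6, add_smul, Finset.sum_add_distrib]⟩
  | smul c F _ h1 =>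
    obtain ⟨φ, h3, h4⟩ := h1
    exact ⟨c • φ, fun l => (totalDegree_smul_le _ _).trans (h3 l), fun y => by
      simp [h4, mul_smul, Finset.smul_sum]⟩

/-- A basis padded with zeros, so that the number of vectors is exactly n. -/
lemma exists_span_range_eq (L : Submodule ℝ H10) [FiniteDimensional ℝ L] {n : ℕ}
    (h : Module.finrank ℝ L ≤ n) : ∃ v : Fin n → H10, Submodule.span ℝ (Set.range v) = L := by
  let b := Module.finBasis ℝ L
  refine ⟨fun l => if hl : (l : ℕ) < Module.finrank ℝ L then b ⟨l, hl⟩ else 0, le_antisymm ?_ ?_⟩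
  · rw [Submodule.span_le]
    rintro _ ⟨l, rfl⟩
    change dite _ _ _ ∈ L
    split_ifs
    · exact (b _).2
    · exact Submodule.zero_mem _
  · intro w hw
    have h1 : w = ∑ l, b.repr ⟨w, hw⟩ l • (b l : H10) := by
      have h2 := congrArg Subtype.val (b.sum_repr ⟨w, hw⟩)
      rw [AddSubmonoidClass.coe_finsetSum] at h2
      exact h2.symm
    rw [h1]
    refine Submodule.sum_mem _ fun l _ => Submodule.smul_mem _ _ (Submodule.subset_span ?_)
    exact ⟨⟨l, l.2.trans_le h⟩, by simp⟩

open MvPolynomial in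
/-- In a representation by polynomials of degree at most `k`, one of which has degree `k`, all
polynomials can be made to have degree `k`. -/
lemma exists_totalDegree_eq {ι : Type*} [Fintype ι] {k : ℕ} {φ : ι → MvPolynomial (Fin 4) ℝ}
    (hφ : ∀ l, (φ l).totalDegree ≤ k) {l₀ : ι} (h0 : (φ l₀).totalDegree = k) (v : ι → H10) :
    ∃ (ψ : ι → MvPolynomial (Fin 4) ℝ) (w : ι → H10), (∀ l, (ψ l).totalDegree = k) ∧
      ∀ y, ∑ l, eval y (ψ l) • w l = ∑ l, eval y (φ l) • v l := by
  classical
  -- `c` marks the polynomials of too low degree. Adding φ_{l₀} to these makes their degree k, and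
  -- the excess φ_{l₀} ∑ c_m v_m is subtracted from the vector at l₀.
  let c : ι → ℝ := fun l => if (φ l).totalDegree = k then 0 else 1
  refine ⟨fun l => φ l + C (c l) * φ l₀, fun l => v l - if l = l₀ then ∑ m, c m • v m else 0,
    fun l => ?_, fun y => ?_⟩
  · by_cases hl : (φ l).totalDegree = k
    · simp [c, hl]
    · have h1 : (φ l).totalDegree < (φ l₀).totalDegree := by
        rw [h0]; exact lt_of_le_of_ne (hφ l) hl
      simp only [c, hl, if_false, C_1, one_mul]
      rw [totalDegree_add_eq_right_of_totalDegree_lt h1, h0]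
  · have hc : c l₀ = 0 := if_pos h0
    simp only [smul_sub, Finset.sum_sub_distrib, smul_ite, smul_zero, Finset.sum_ite_eq',
      Finset.mem_univ, if_true, map_add, map_mul, eval_C, hc, zero_mul, add_zero, add_smul,
      Finset.sum_add_distrib, Finset.smul_sum, smul_smul]
    rw [add_sub_assoc, add_eq_left, sub_eq_zero]
    exact Finset.sum_congr rfl fun l _ => by rw [mul_comm]

open MvPolynomial in
lemma totalDegree_geomSum {θ : ℝ} (hθ : θ ≠ 0) (i : Fin 4) (k : ℕ) :
    (∑ m ∈ Finset.range (k + 1), C (θ ^ m) * X i ^ m : MvPolynomial (Fin 4) ℝ).totalDegree = k := by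
  have h : ∀ m, (C (θ ^ m) * X i ^ m : MvPolynomial (Fin 4) ℝ).totalDegree = m := by
    intro m
    rw [C_mul_X_pow_eq_monomial, totalDegree_monomial _ (pow_ne_zero _ hθ)]
    simp
  induction k with
  | zero => simp
  | succ k ih =>
    rw [Finset.sum_range_succ, totalDegree_add_eq_right_of_totalDegree_lt, h]
    rw [ih, h]
    exact k.lt_succ_self

open MvPolynomial in
/-- The partial sums of the Neumann series have representations with `8 k + 5` terms. -/
theorem exists_representation {θ : ℝ} (hθ : θ ≠ 0) (g : H10) (k : ℕ) :
    ∃ (v : Fin (8 * k + 5) → H10) (φ : Fin (8 * k + 5) → MvPolynomial (Fin 4) ℝ),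
      (∀ l, (φ l).totalDegree = k) ∧
      ∀ y, ∑ m ∈ Finset.range (k + 1), (paramOp θ y ^ m) g = ∑ l, eval y (φ l) • v l := by
  obtain rfl | ⟨k, rfl⟩ : k = 0 ∨ ∃ k', k = k' + 1 := by
    cases k
    · exact Or.inl rfl
    · exact Or.inr ⟨_, rfl⟩
  -- For k = 0 the sum is g alone. The general count would give 4 + 1 + 1 + 1 = 7 terms, more than
  -- the five allowed.
  · refine ⟨Pi.single 0 g, fun _ => 1, by simp, fun y => ?_⟩
    simp
  obtain ⟨s, h, z₀, z₁, hg, hs, hh, hz₀, hz₁⟩ := exists_decomposition g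
  set K := k + 1 with hK
  set L := cornerSpan h K ⊔ edgeSpan z₀ K ⊔ edgeSpan z₁ K with hL
  -- (4K - 1) + 2(2K + 1) = 8K + 1; the other four terms are reserved for s.
  have hfin : Module.finrank ℝ L ≤ 8 * K + 1 := by
    have h1 := Submodule.finrank_add_le_finrank_add_finrank (cornerSpan h K ⊔ edgeSpan z₀ K)
      (edgeSpan z₁ K)
    have h2 := Submodule.finrank_add_le_finrank_add_finrank (cornerSpan h K) (edgeSpan z₀ K)
    have h3 : Module.finrank ℝ (cornerSpan h K) ≤ 4 * k + 3 := finrank_cornerSpan_succ_le h k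
    have h4 := finrank_edgeSpan_le z₀ K
    have h5 := finrank_edgeSpan_le z₁ K
    rw [hL]
    omega
  obtain ⟨v, hv⟩ := exists_span_range_eq L hfin
  have hmem : (fun y => ∑ m ∈ Finset.range (K + 1), (paramOp θ y ^ m) (h + z₀ + z₁)) ∈
      polyFun K L := by
    have e : (fun y => ∑ m ∈ Finset.range (K + 1), (paramOp θ y ^ m) (h + z₀ + z₁)) =
        (fun y => ∑ m ∈ Finset.range (K + 1), (paramOp θ y ^ m) h) +
        (fun y => ∑ m ∈ Finset.range (K + 1), (paramOp θ y ^ m) z₀) +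
        (fun y => ∑ m ∈ Finset.range (K + 1), (paramOp θ y ^ m) z₁) := by
      funext y
      simp [Finset.sum_add_distrib]
    rw [e]
    refine Submodule.add_mem _ (Submodule.add_mem _ ?_ ?_) ?_
    · exact polyFun_mono le_rfl (le_sup_left.trans le_sup_left) (sum_paramOp_pow_mem_polyFun θ
        (cornerSpan_mono h) (fun k v hv i => quadOp_mem_cornerSpan hh hv i)
        (self_mem_cornerSpan h 0) K)
    · exact polyFun_mono le_rfl (le_sup_right.trans le_sup_left) (sum_paramOp_pow_mem_polyFun θ
        (edgeSpan_mono z₀) (fun k v hv i => quadOp_mem_edgeSpan one_ne_zero hz₀ hv i)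
        (self_mem_edgeSpan z₀ 0) K)
    · exact polyFun_mono le_rfl le_sup_right (sum_paramOp_pow_mem_polyFun θ
        (edgeSpan_mono z₁) (fun k v hv i => quadOp_mem_edgeSpan zero_ne_one hz₁ hv i)
        (self_mem_edgeSpan z₁ 0) K)
  rw [← hv] at hmem
  obtain ⟨φ, hφ, hsum⟩ := exists_of_mem_polyFun v hmem
  -- The Qᵢ act on s as orthogonal idempotents, so Qᵢs is an eigenvector of B(y) with eigenvalue
  -- θyᵢ.
  have hpow : ∀ (y : Fin 4 → ℝ) (i : Fin 4) (m : ℕ),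
      (paramOp θ y ^ m) (quadOp i s) = (θ ^ m * y i ^ m) • quadOp i s := by
    intro y i m
    induction m with
    | zero => simp
    | succ m ih =>
      rw [pow_succ', mul_apply_eq_comp, ih, map_smul, paramOp_apply]
      simp only [quadOp_quadOp_of_grad (hs i), smul_ite, smul_zero, Finset.sum_ite_eq,
        Finset.mem_univ, if_true, smul_smul]
      congr 1
      ring
  let Φ : Fin 4 ⊕ Fin (8 * K + 1) → MvPolynomial (Fin 4) ℝ :=
    Sum.elim (fun i => ∑ m ∈ Finset.range (K + 1), C (θ ^ m) * X i ^ m) φ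
  let W : Fin 4 ⊕ Fin (8 * K + 1) → H10 := Sum.elim (fun i => quadOp i s) v
  have hΦ : ∀ l, (Φ l).totalDegree ≤ K := by
    rintro (i | l)
    · exact (totalDegree_geomSum hθ i K).le
    · exact hφ l
  -- The geometric sum in y₀ has degree exactly K because θ ≠ 0, whether or not its vector vanishes.
  obtain ⟨ψ, w, h1, h2⟩ := exists_totalDegree_eq hΦ (l₀ := Sum.inl 0) (totalDegree_geomSum hθ 0 K) W
  let e : Fin (8 * K + 5) ≃ Fin 4 ⊕ Fin (8 * K + 1) :=
    (finCongr (by omega)).trans finSumFinEquiv.symm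
  refine ⟨w ∘ e, ψ ∘ e, fun l => h1 _, fun y => ?_⟩
  have h3 : ∑ l, eval y ((ψ ∘ e) l) • (w ∘ e) l = ∑ l, eval y (ψ l) • w l :=
    e.sum_comp fun l => eval y (ψ l) • w l
  rw [h3, h2, Fintype.sum_sum_type]
  simp only [Φ, W, Sum.elim_inl, Sum.elim_inr]
  have hg' : g = s + (h + z₀ + z₁) := by rw [hg]; abel
  rw [← hsum, hg']
  simp only [map_add _ s, Finset.sum_add_distrib]
  congr 1
  conv_lhs => rw [← sum_quadOp s]
  simp only [map_sum, hpow, map_mul, map_pow, eval_C, eval_X, Finset.sum_smul]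
  exact Finset.sum_comm

end Spans

/-! ### Taylor polynomials in terms of mixed partial derivatives. -/

section Taylor

open Filter Topology

/-! ### Taylor coefficients -/

/-- The iterated partial derivative along a list of directions. -/
noncomputable def wordDeriv (l : List (Fin 4)) (w : (Fin 4 → ℝ) → H10) : (Fin 4 → ℝ) → H10 :=
  l.foldr partialDeriv w

lemma wordDeriv_cons (a : Fin 4) (l : List (Fin 4)) (w : (Fin 4 → ℝ) → H10) :
    wordDeriv (a :: l) w = partialDeriv a (wordDeriv l w) := rfl

lemma wordDeriv_ofFn {w : (Fin 4 → ℝ) → H10} {m : ℕ} (r : Fin m → Fin 4) {x : Fin 4 → ℝ}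
    (hw : AnalyticAt ℝ w x) : wordDeriv (List.ofFn r) w x =
      iteratedFDeriv ℝ m w x (fun j => Pi.single (r j) 1) := by
  induction m generalizing x with
  | zero => simp [wordDeriv]
  | succ m ih =>
    have h1 : wordDeriv (List.ofFn fun j => r (Fin.succ j)) w =ᶠ[𝓝 x]
        fun y => iteratedFDeriv ℝ m w y (fun j => Pi.single (r j.succ) 1) := by
      filter_upwards [hw.eventually_analyticAt] with y hy using ih _ hy
    have h2 : DifferentiableAt ℝ (iteratedFDeriv ℝ m w) x :=
      (hw.contDiffAt (n := ω)).differentiableAt_iteratedFDeriv (by exact_mod_cast WithTop.coe_lt_top _)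
    rw [List.ofFn_succ, wordDeriv_cons, partialDeriv, h1.lineDeriv_eq,
      iteratedFDeriv_succ_apply_left]
    have h3 := (h2.hasFDerivAt.continuousMultilinear_apply_const
      (fun j => (Pi.single (r j.succ) 1 : Fin 4 → ℝ))).hasLineDerivAt (Pi.single (r 0) 1)
    rw [h3.lineDeriv]
    rfl

/-- An exchange of the two outermost directions is the symmetry of the iterated derivative. Under
further derivatives the identity is needed near x, which holds because analyticity is an open
condition. -/
lemma wordDeriv_perm {w : (Fin 4 → ℝ) → H10} {l l' : List (Fin 4)} (h : l.Perm l')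
    {x : Fin 4 → ℝ} (hw : AnalyticAt ℝ w x) : wordDeriv l w x = wordDeriv l' w x := by
  induction h generalizing x with
  | nil => rfl
  | cons a _ ih =>
    refine EventuallyEq.lineDeriv_eq ?_
    filter_upwards [hw.eventually_analyticAt] with y hy using ih hy
  | swap a b l =>
    have key : ∀ a b : Fin 4, a :: b :: l = List.ofFn (Fin.cons a (Fin.cons b l.get) :
        Fin (l.length + 1 + 1) → Fin 4) := by
      intro a b
      simp [List.ofFn_succ, Fin.cons_succ]
    rw [key, key, wordDeriv_ofFn _ hw, wordDeriv_ofFn _ hw,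
      ← (hw.contDiffAt (n := ω)).iteratedFDeriv_comp_perm _ (Equiv.swap 0 1)]
    congr 1
    funext j
    refine Fin.cases ?_ (fun j => Fin.cases ?_ (fun j => ?_) j) j
    · simp
    · simp
    · have h0 : (Equiv.swap (0 : Fin (l.length + 1 + 1)) 1) j.succ.succ = j.succ.succ :=
        Equiv.swap_apply_of_ne_of_ne (Fin.succ_ne_zero _) (by simp [Fin.ext_iff])
      simp [h0]
  | trans _ _ h1 h2 => exact (h1 hw).trans (h2 hw)

/-- The list of directions of a multi-index. -/
def indexList (ν : Fin 4 → ℕ) : List (Fin 4) :=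
  List.replicate (ν 0) 0 ++ (List.replicate (ν 1) 1 ++
    (List.replicate (ν 2) 2 ++ List.replicate (ν 3) 3))

lemma foldr_replicate {α β : Type*} (f : α → β → β) (a : α) (n : ℕ) (b : β) :
    (List.replicate n a).foldr f b = (f a)^[n] b := by
  induction n with
  | zero => rfl
  | succ n ih => rw [List.replicate_succ, List.foldr_cons, ih, Function.iterate_succ_apply']

lemma mixedDeriv_eq (ν : Fin 4 → ℕ) (w : (Fin 4 → ℝ) → H10) :
    mixedDeriv ν w = wordDeriv (indexList ν) w := by
  simp only [wordDeriv, indexList, List.foldr_append, foldr_replicate]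
  rfl

lemma count_indexList (ν : Fin 4 → ℕ) (i : Fin 4) : (indexList ν).count i = ν i := by
  fin_cases i <;> simp [indexList, List.count_replicate]

lemma wordDeriv_eq_mixedDeriv {w : (Fin 4 → ℝ) → H10} (l : List (Fin 4)) {x : Fin 4 → ℝ}
    (hw : AnalyticAt ℝ w x) : wordDeriv l w x = mixedDeriv (fun i => l.count i) w x := by
  rw [mixedDeriv_eq]
  refine wordDeriv_perm (List.perm_iff_count.2 fun i => ?_) hw
  rw [count_indexList]

lemma sum_single_apply_eq_count {m : ℕ} (r : Fin m → Fin 4) (i : Fin 4) :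
    (∑ j, Finsupp.single (r j) 1 : Fin 4 →₀ ℕ) i = (List.ofFn r).count i := by
  induction m with
  | zero => simp
  | succ m ih =>
    rw [Fin.sum_univ_succ, Finsupp.add_apply, ih, List.ofFn_succ, List.count_cons,
      Finsupp.single_apply, add_comm]
    simp

open MvPolynomial in
/-- The `m`-th Taylor polynomial of an analytic function in terms of mixed partial derivatives. -/
theorem sum_mixedDeriv {w : (Fin 4 → ℝ) → H10} {x : Fin 4 → ℝ} (hw : AnalyticAt ℝ w x) (m : ℕ)
    (y : Fin 4 → ℝ) :
    ∑ ν ∈ Finset.piAntidiag (Finset.univ : Finset (Fin 4)) m,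
      (∏ i, y i ^ ν i) • (∏ i, ((ν i).factorial : ℝ))⁻¹ • mixedDeriv ν w x =
    (m.factorial : ℝ)⁻¹ • iteratedFDeriv ℝ m w x (fun _ => y) := by
  -- Λ sends X^ν to y^ν ∂_ν w(x). Evaluating Λ on (∑ Xᵢ)^m, expanded once over words and once by the
  -- multinomial theorem, gives the two sides.
  let Λ : MvPolynomial (Fin 4) ℝ →ₗ[ℝ] H10 := (basisMonomials (Fin 4) ℝ).constr ℝ
    fun ν => (∏ i, y i ^ ν i) • mixedDeriv ν w x
  have hΛ : ∀ ν : Fin 4 →₀ ℕ, Λ (monomial ν 1) = (∏ i, y i ^ ν i) • mixedDeriv ν w x := by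
    intro ν
    have := (basisMonomials (Fin 4) ℝ).constr_basis ℝ
      (fun ν => (∏ i, y i ^ ν i) • mixedDeriv ν w x) ν
    rwa [coe_basisMonomials] at this
  have h1 : Λ ((∑ i, X i) ^ m) = iteratedFDeriv ℝ m w x (fun _ => y) := by
    have hy : (fun _ : Fin m => y) = fun _ => ∑ i, y i • (Pi.single i 1 : Fin 4 → ℝ) := by
      funext _
      exact (pi_eq_sum_univ' y).trans (by simp)
    rw [Fintype.sum_pow, map_sum, hy, ContinuousMultilinearMap.map_sum]
    refine Finset.sum_congr rfl fun r _ => ?_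
    have h2 : (∏ j, X (r j) : MvPolynomial (Fin 4) ℝ) =
        monomial (∑ j, Finsupp.single (r j) 1) 1 := (monomial_sum_one _ _).symm
    have h3 : ∏ j, y (r j) = ∏ i, y i ^ (∑ j, Finsupp.single (r j) 1 : Fin 4 →₀ ℕ) i := by
      have h4 := congrArg (eval y) h2
      rw [eval_monomial, one_mul, Finsupp.prod_fintype _ _ (fun i => pow_zero _), map_prod] at h4
      simpa only [eval_X] using h4
    rw [h2, hΛ, ContinuousMultilinearMap.map_smul_univ, ← h3, ← wordDeriv_ofFn r hw,
      wordDeriv_eq_mixedDeriv _ hw]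
    congr 3
    funext i
    exact sum_single_apply_eq_count r i
  rw [← h1, Finset.sum_pow_eq_sum_piAntidiag, map_sum, Finset.smul_sum]
  refine Finset.sum_congr rfl fun ν hν => ?_
  have hν' : ∑ i, ν i = m := (Finset.mem_piAntidiag.1 hν).1
  have h5 : ((Nat.multinomial Finset.univ ν : ℕ) : MvPolynomial (Fin 4) ℝ) * ∏ i, X i ^ ν i =
      (Nat.multinomial Finset.univ ν : ℝ) • monomial (Finsupp.equivFunOnFinite.symm ν) 1 := by
    rw [monomial_eq, Finsupp.prod_fintype _ _ (fun i => pow_zero _), smul_eq_C_mul]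
    simp
  have h6 : (∏ i, ((ν i).factorial : ℝ)) * Nat.multinomial Finset.univ ν = m.factorial := by
    have := Nat.multinomial_spec Finset.univ ν
    rw [hν'] at this
    exact_mod_cast this
  have h7 : (∏ i, ((ν i).factorial : ℝ)) ≠ 0 :=
    Finset.prod_ne_zero_iff.2 fun i _ => by exact_mod_cast (ν i).factorial_ne_zero
  rw [h5, map_smul, hΛ, smul_smul, smul_smul, smul_smul]
  congr 1
  have h8 : (Nat.multinomial Finset.univ ν : ℝ) ≠ 0 := by
    intro h
    rw [h, mul_zero] at h6
    exact m.factorial_ne_zero (by exact_mod_cast h6.symm)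
  rw [← h6]
  simp only [Finsupp.equivFunOnFinite_symm_apply_apply]
  field_simp

end Taylor

/-! ### The solution map as a Neumann series, and Kolmogorov widths. -/

section Solution

open Filter Topology

/-! ### The solution map -/

lemma coeFn_sum_quadMul (θ : ℝ) (y : Fin 4 → ℝ) (G : Lp Plane 2 volD) :
    (∑ i, (y i * θ) • quadMul i) G =ᵐ[volD] fun x => (1 - coefficient θ y x) • G x := by
  have h0 : (∑ i, (y i * θ) • quadMul i) G = (y 0 * θ) • quadMul 0 G + (y 1 * θ) • quadMul 1 G +
      (y 2 * θ) • quadMul 2 G + (y 3 * θ) • quadMul 3 G := by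
    simp [Fin.sum_univ_four]
  have hs : ∀ᵐ x ∂volD, ∀ i, ((y i * θ) • quadMul i G : Lp Plane 2 volD) x =
      (y i * θ) • quadMul i G x := ae_all_iff.2 fun i => Lp.coeFn_smul _ _
  have hq : ∀ᵐ x ∂volD, ∀ i, quadMul i G x = (quadrant i).indicator (fun _ => (1 : ℝ)) x • G x :=
    ae_all_iff.2 fun i => coeFn_quadMul i G
  rw [h0]
  filter_upwards [hs, hq,
    Lp.coeFn_add ((y 0 * θ) • quadMul 0 G + (y 1 * θ) • quadMul 1 G + (y 2 * θ) • quadMul 2 G)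
      ((y 3 * θ) • quadMul 3 G),
    Lp.coeFn_add ((y 0 * θ) • quadMul 0 G + (y 1 * θ) • quadMul 1 G) ((y 2 * θ) • quadMul 2 G),
    Lp.coeFn_add ((y 0 * θ) • quadMul 0 G) ((y 1 * θ) • quadMul 1 G)] with x h1 h2 h3 h4 h5
  have hθ : ∀ i, (quadrant i).indicator (fun _ => θ) x =
      θ * (quadrant i).indicator (fun _ => (1 : ℝ)) x := by
    intro i
    by_cases hx : x ∈ quadrant i <;> simp [hx]
  rw [h3, Pi.add_apply, h4, Pi.add_apply, h5, Pi.add_apply, h1, h1, h1, h1, h2, h2, h2, h2,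
    coefficient, Fin.sum_univ_four, hθ, hθ, hθ, hθ]
  module

lemma paramOp_eq_compress (θ : ℝ) (y : Fin 4 → ℝ) (v : H10) :
    paramOp θ y v = compress (∑ i, (y i * θ) • quadMul i) v := by
  refine ext_inner_right ℝ fun w => ?_
  rw [inner_compress_left, paramOp_apply, sum_inner, sum_apply, sum_inner]
  refine Finset.sum_congr rfl fun i _ => ?_
  rw [inner_smul_left, quadOp, inner_compress_left, smul_apply,
    inner_smul_left]

/-- The whole sum is the compression of the single multiplier 1 - a(·,y), bounded by θ; estimating
the four terms separately would lose the disjointness of the quadrants. -/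
lemma norm_paramOp_apply_le {θ : ℝ} (h0 : 0 < θ) {y : Fin 4 → ℝ} (hy : y ∈ paramDomain)
    (v : H10) : ‖paramOp θ y v‖ ≤ θ * ‖v‖ := by
  rw [paramOp_eq_compress]
  refine norm_compress_apply_le h0.le (fun G => ?_) v
  refine Lp.norm_le_mul_norm_of_ae_le_mul ?_
  filter_upwards [coeFn_sum_quadMul θ y G] with x hx
  rw [hx, norm_smul]
  refine mul_le_mul_of_nonneg_right ?_ (norm_nonneg _)
  have h1 := coefficient_bounds h0 hy x
  rw [Real.norm_eq_abs, abs_le]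
  constructor <;> linarith [h1.1, h1.2]

lemma diffusionForm_coefficient (θ : ℝ) (y : Fin 4 → ℝ) (u v : H10) :
    diffusionForm (coefficient θ y) u v = inner ℝ (u - paramOp θ y u) v := by
  rw [inner_sub_left, paramOp_eq_compress, inner_compress_left, ← integral_inner, L2.inner_def,
    ← integral_sub (integrable_inner u v) (L2.integrable_inner _ _), diffusionForm]
  refine integral_congr_ae ?_
  filter_upwards [coeFn_sum_quadMul θ y u.grad] with x hx
  rw [hx, real_inner_smul_left]
  ring

lemma inner_invAbar (f : StrongDual ℝ H10) (v : H10) : inner ℝ (invAbar f) v = f v := by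
  rw [← (isWeakSolution_invAbar f (invAbar f)).2 rfl v, diffusionForm, ← integral_inner]
  simp

lemma solution_sub_paramOp {θ : ℝ} (h0 : 0 < θ) (h1 : θ < 1) (f : StrongDual ℝ H10)
    {y : Fin 4 → ℝ} (hy : y ∈ paramDomain) :
    solution θ f y - paramOp θ y (solution θ f y) = invAbar f := by
  refine ext_inner_right ℝ fun v => ?_
  rw [← diffusionForm_coefficient, inner_invAbar]
  exact (isWeakSolution_solution h0 h1 f hy _).2 rfl v

lemma norm_solution_le {θ : ℝ} (h0 : 0 < θ) (h1 : θ < 1) (f : StrongDual ℝ H10)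
    {y : Fin 4 → ℝ} (hy : y ∈ paramDomain) :
    ‖solution θ f y‖ ≤ ‖invAbar f‖ / (1 - θ) := by
  have h2 := solution_sub_paramOp h0 h1 f hy
  have h3 := norm_paramOp_apply_le h0 hy (solution θ f y)
  have h4 := norm_sub_norm_le (solution θ f y) (paramOp θ y (solution θ f y))
  rw [h2] at h4
  rw [le_div_iff₀ (by linarith)]
  linarith

/-- Substituting g = u - B(y)u makes the sum telescope, so the remainder is exactly B(y)^k u. -/
lemma solution_sub_sum {θ : ℝ} (h0 : 0 < θ) (h1 : θ < 1) (f : StrongDual ℝ H10)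
    {y : Fin 4 → ℝ} (hy : y ∈ paramDomain) (k : ℕ) :
    solution θ f y - ∑ m ∈ Finset.range k, (paramOp θ y ^ m) (invAbar f) =
      (paramOp θ y ^ k) (solution θ f y) := by
  induction k with
  | zero => simp
  | succ k ih =>
    rw [Finset.sum_range_succ, ← sub_sub, ih, ← map_sub, pow_succ, mul_apply_eq_comp,
      ← solution_sub_paramOp h0 h1 f hy, sub_sub_cancel]

lemma norm_solution_sub_sum_le {θ : ℝ} (h0 : 0 < θ) (h1 : θ < 1) (f : StrongDual ℝ H10)
    {y : Fin 4 → ℝ} (hy : y ∈ paramDomain) (k : ℕ) :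
    ‖solution θ f y - ∑ m ∈ Finset.range k, (paramOp θ y ^ m) (invAbar f)‖ ≤
      ‖invAbar f‖ / (1 - θ) * θ ^ k := by
  rw [solution_sub_sum h0 h1 f hy]
  have h2 : ∀ v, ‖(paramOp θ y ^ k) v‖ ≤ θ ^ k * ‖v‖ := by
    intro v
    induction k with
    | zero => simp
    | succ k ih =>
      rw [pow_succ', mul_apply_eq_comp, pow_succ', mul_assoc]
      exact (norm_paramOp_apply_le h0 hy _).trans (mul_le_mul_of_nonneg_left ih h0.le)
  rw [mul_comm]
  exact (h2 _).trans (mul_le_mul_of_nonneg_left (norm_solution_le h0 h1 f hy) (by positivity))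

/-- A solution `u` of `u(y) - ∑ᵢ yᵢ Bᵢ u(y) = g` is analytic at zero, with the Neumann series as
power series. -/
theorem analyticAt_and_iteratedFDeriv_of_fixed_point {V : Type*} [NormedAddCommGroup V]
    [NormedSpace ℝ V] [CompleteSpace V] (B : Fin 4 → V →L[ℝ] V) (g : V) {u : (Fin 4 → ℝ) → V}
    (hu : ∀ᶠ y in 𝓝 0, u y - ∑ i, y i • B i (u y) = g) :
    AnalyticAt ℝ u 0 ∧ ∀ (m : ℕ) (y : Fin 4 → ℝ), iteratedFDeriv ℝ m u 0 (fun _ => y) =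
      m.factorial • (fun v => ∑ i, y i • B i v)^[m] g := by
  let P : (Fin 4 → ℝ) →L[ℝ] V →L[ℝ] V :=
    ∑ i, (ContinuousLinearMap.proj (R := ℝ) (φ := fun _ : Fin 4 => ℝ) i).smulRight (B i)
  have hP : ∀ y v, P y v = ∑ i, y i • B i v := by
    intro y v
    simp [P]
  have h := hasFPowerSeriesOnBall_inverse_one_sub ℝ (V →L[ℝ] V)
  rw [← map_zero P] at h
  have hp := (ContinuousLinearMap.apply ℝ V g).comp_hasFPowerSeriesOnBall
    h.compContinuousLinearMap
  have hn : ∀ᶠ y in 𝓝 (0 : Fin 4 → ℝ), ‖P y‖ < 1 := by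
    have h1 : ContinuousAt (fun y => ‖P y‖) 0 := P.continuous.norm.continuousAt
    exact h1.eventually_lt continuousAt_const (by simp)
  -- Near zero u is the geometric series for (1 - T)⁻¹, composed with the linear map P and applied
  -- to g; its homogeneous terms are the derivatives sought.
  have he : u =ᶠ[𝓝 0] fun y => Ring.inverse (1 - P y) g := by
    filter_upwards [hu, hn] with y h1 h2
    have h3 := Ring.inverse_mul_cancel (1 - P y) (isUnit_one_sub_of_norm_lt_one h2)
    have h4 := congrArg (fun A : V →L[ℝ] V => A (u y)) h3
    rw [← h1, ← hP]
    exact h4.symm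
  refine ⟨hp.analyticAt.congr he.symm, fun m y => ?_⟩
  rw [(he.iteratedFDeriv ℝ m).eq_of_nhds]
  refine (hp.factorial_smul y m).symm.trans ?_
  congr 1
  change (List.ofFn fun _ : Fin m => P y).prod g = _
  rw [List.ofFn_const, List.prod_replicate, FunLike.coe_pow_eq_iterate]
  congr 2

/-- The truncated power series of the solution map is the partial sum of the Neumann series. -/
theorem truncatedSeries_eq {θ : ℝ} (h0 : 0 < θ) (h1 : θ < 1) (f : StrongDual ℝ H10) (k : ℕ)
    (y : Fin 4 → ℝ) : truncatedSeries θ f k y =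
      ∑ m ∈ Finset.range (k + 1), (paramOp θ y ^ m) (invAbar f) := by
  have hB : ∀ (y : Fin 4 → ℝ) (v : H10), ∑ i, y i • (θ • quadOp i) v = paramOp θ y v := by
    intro y v
    rw [paramOp_apply]
    refine Finset.sum_congr rfl fun i _ => ?_
    rw [mul_smul]
    rfl
  -- The equation for u(y) is available only on U, which is enough for derivatives at 0.
  have hU : paramDomain ∈ 𝓝 (0 : Fin 4 → ℝ) := by
    rw [paramDomain, ← Set.pi_univ_Icc]
    exact set_pi_mem_nhds Set.finite_univ fun i _ => Icc_mem_nhds (by simp) (by simp)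
  obtain ⟨ha, hd⟩ := analyticAt_and_iteratedFDeriv_of_fixed_point (fun i => θ • quadOp i)
    (invAbar f) (u := solution θ f) (by
      filter_upwards [hU] with y hy
      rw [hB]
      exact solution_sub_paramOp h0 h1 f hy)
  refine Finset.sum_congr rfl fun m _ => ?_
  simp only [taylorCoeff]
  rw [sum_mixedDeriv ha, hd, ← Nat.cast_smul_eq_nsmul ℝ, smul_smul,
    inv_mul_cancel₀ (by exact_mod_cast m.factorial_ne_zero), one_smul, FunLike.coe_pow_eq_iterate]
  congr 2
  funext v
  exact hB y v

/-! ### Infinite dimension and Kolmogorov widths -/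

/-- Bump functions supported in pairwise disjoint open sets are orthogonal in H¹₀(D). -/
lemma exists_linearIndependent : ∃ v : ℕ → H10, LinearIndependent ℝ v := by
  have h0 : (0 : Plane) ∈ square := by intro j; constructor <;> norm_num
  have : Infinite square := by
    refine Set.infinite_coe_iff.2 ?_
    exact infinite_of_mem_nhds (0 : Plane) (isOpen_square.mem_nhds h0)
  obtain ⟨U, hU1, hU2, hU3⟩ := exists_seq_infinite_isOpen_pairwise_disjoint square
  have hex : ∀ n, ∃ (φ : Plane → ℝ) (x : Plane), IsTest φ ∧ x ∈ square ∧ φ x = 1 ∧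
      tsupport φ ⊆ Subtype.val '' U n := by
    intro n
    obtain ⟨x, hx⟩ := (hU1 n).nonempty
    have ho : IsOpen (Subtype.val '' U n : Set Plane) := isOpen_square.isOpenMap_subtype_val _ (hU2 n)
    obtain ⟨φ, h1, h2, h3, -, h4⟩ := exists_contDiff_tsupport_subset (n := (⊤ : ℕ∞))
      (ho.mem_nhds ⟨x, hx, rfl⟩)
    refine ⟨φ, x, ⟨h3, h2, h1.trans ?_⟩, x.2, h4, h1⟩
    rintro _ ⟨z, -, rfl⟩
    exact z.2
  choose φ x hφ hx hφx hsupp using hex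
  let v : ℕ → H10 := fun n => (⟨(hφ n).pair, Submodule.le_topologicalClosure _ (hφ n).pair_mem⟩ :
    ↥graphH10)
  refine ⟨v, linearIndependent_of_ne_zero_of_inner_eq_zero (𝕜 := ℝ) (fun n hn => ?_)
    fun m n hmn => ?_⟩
  · have h1 : (hφ n).memLp.toLp (φ n) = 0 := congrArg H10.toL2 hn
    have h2 : φ n =ᵐ[volD] fun _ => 0 := by
      have h3 := (hφ n).memLp.coeFn_toLp
      rw [h1] at h3
      exact h3.symm.trans (Lp.coeFn_zero _ _ _)
    have h4 := Measure.eqOn_open_of_ae_eq h2 isOpen_square (hφ n).1.continuous.continuousOn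
      continuousOn_const (hx n)
    rw [hφx] at h4
    exact one_ne_zero h4
  · change inner ℝ (v m) (v n) = 0
    rw [← integral_inner]
    refine integral_eq_zero_of_ae ?_
    filter_upwards [(hφ m).memLp_gradient.coeFn_toLp, (hφ n).memLp_gradient.coeFn_toLp]
      with z h1 h2
    change inner ℝ ((hφ m).memLp_gradient.toLp (∇ (φ m)) z)
      ((hφ n).memLp_gradient.toLp (∇ (φ n)) z) = 0
    rw [h1, h2]
    have hg : ∀ n, ∇ (φ n) z ≠ 0 → z ∈ Subtype.val '' U n := by
      intro n h
      refine hsupp n (support_fderiv_subset ℝ fun h3 => h ?_)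
      rw [gradient, h3, map_zero]
    by_cases hm : ∇ (φ m) z = 0
    · rw [hm, inner_zero_left]
    by_cases hn : ∇ (φ n) z = 0
    · rw [hn, inner_zero_right]
    obtain ⟨a, ha, rfl⟩ := hg m hm
    obtain ⟨b, hb, hab⟩ := hg n hn
    obtain rfl : b = a := Subtype.ext hab
    exact absurd hb (Set.disjoint_left.1 (hU3 hmn) ha)

lemma not_finiteDimensional : ¬ FiniteDimensional ℝ H10 := by
  intro h
  obtain ⟨v, hv⟩ := exists_linearIndependent
  exact not_finite_iff_infinite.2 (inferInstanceAs (Infinite ℕ)) hv.finite_of_isNoetherian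

/-- The width is taken over subspaces of dimension exactly n; since H¹₀(D) is infinite-dimensional,
smaller ones can be enlarged one vector at a time. -/
lemma exists_le_rank_eq (L : Submodule ℝ H10) [FiniteDimensional ℝ L] {n : ℕ}
    (hn : Module.finrank ℝ L ≤ n) : ∃ W : Submodule ℝ H10, L ≤ W ∧ Module.rank ℝ W = n := by
  obtain ⟨d, rfl⟩ := Nat.exists_eq_add_of_le hn
  suffices h : ∃ W : Submodule ℝ H10, L ≤ W ∧ FiniteDimensional ℝ W ∧
      Module.finrank ℝ W = Module.finrank ℝ L + d by
    obtain ⟨W, h1, h2, h3⟩ := h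
    exact ⟨W, h1, by rw [← Module.finrank_eq_rank, h3]⟩
  clear hn
  induction d with
  | zero => exact ⟨L, le_rfl, inferInstance, rfl⟩
  | succ d ih =>
    obtain ⟨W, h1, h2, h3⟩ := ih
    have hW : W ≠ ⊤ := by
      rintro rfl
      exact not_finiteDimensional (Module.finite_def.2 (Submodule.fg_top _ |>.1 h2.1))
    obtain ⟨v, hv⟩ : ∃ v, v ∉ W := by
      by_contra! h
      exact hW (eq_top_iff.2 fun v _ => h v)
    have hv0 : v ≠ 0 := by
      rintro rfl
      exact hv W.zero_mem
    have hdisj : W ⊓ Submodule.span ℝ {v} = ⊥ := by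
      rw [← disjoint_iff, Submodule.disjoint_span_singleton' hv0]
      exact hv
    have h4 := Submodule.finrank_sup_add_finrank_inf_eq W (Submodule.span ℝ {v})
    rw [hdisj, finrank_bot, finrank_span_singleton hv0] at h4
    exact ⟨W ⊔ Submodule.span ℝ {v}, h1.trans le_sup_left, inferInstance, by omega⟩

lemma kolmogorovWidth_le {K : Set H10} {n : ℕ} (L : Submodule ℝ H10) [FiniteDimensional ℝ L]
    (hn : Module.finrank ℝ L ≤ n) {r : ℝ} (h : ∀ u ∈ K, ∃ w ∈ L, ‖u - w‖ ≤ r) :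
    kolmogorovWidth K n ≤ ENNReal.ofReal r := by
  obtain ⟨W, h1, h2⟩ := exists_le_rank_eq L hn
  refine (iInf₂_le W h2).trans (iSup₂_le fun u hu => ?_)
  obtain ⟨w, hw, hr⟩ := h u hu
  refine (Metric.infEDist_le_edist_of_mem (h1 hw)).trans ?_
  rw [edist_dist, dist_eq_norm]
  exact ENNReal.ofReal_le_ofReal hr

end Solution

end FourSquares

/-! ### The representation with 8k + 5 terms and the width bound. -/

theorem corollary4p2 (θ : ℝ) (hθ0 : 0 < θ) (hθ1 : θ < 1) :
    (∀ (f : StrongDual ℝ FourSquares.H10) (k : ℕ),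
      ∃ (v : Fin (8 * k + 5) → FourSquares.H10)
        (φ : Fin (8 * k + 5) → MvPolynomial (Fin 4) ℝ),
        (∀ l, (φ l).totalDegree = k) ∧
        (∀ y : Fin 4 → ℝ,
          FourSquares.truncatedSeries θ f k y = ∑ l, MvPolynomial.eval y (φ l) • v l) ∧
        (∀ y ∈ FourSquares.paramDomain,
          ‖FourSquares.solution θ f y - ∑ l, MvPolynomial.eval y (φ l) • v l‖ ≤
            ‖FourSquares.invAbar f‖ / (1 - θ) * θ ^ (k + 1))) ∧
    (∃ C : ℝ, ∀ (f : StrongDual ℝ FourSquares.H10) (n : ℕ),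
      FourSquares.kolmogorovWidth (FourSquares.solution θ f '' FourSquares.paramDomain) n ≤
        ENNReal.ofReal (C * ‖FourSquares.invAbar f‖ * Real.exp (-(|Real.log θ| / 8 * n)))) := by
  refine ⟨fun f k => ?_, θ⁻¹ / (1 - θ), fun f n => ?_⟩
  · obtain ⟨v, φ, h1, h2⟩ :=
      FourSquares.exists_representation hθ0.ne' (FourSquares.invAbar f) k
    refine ⟨v, φ, h1, fun y => ?_, fun y hy => ?_⟩
    · rw [FourSquares.truncatedSeries_eq hθ0 hθ1, h2]
    · rw [← h2]
      exact FourSquares.norm_solution_sub_sum_le hθ0 hθ1 f hy (k + 1)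
  -- The factor θ⁻¹ in the constant pays for the gap between the available power j and n/8, which
  -- may exceed j by at most one.
  · have hexp : ∀ j : ℕ, (n : ℝ) / 8 ≤ j + 1 →
        ‖FourSquares.invAbar f‖ / (1 - θ) * θ ^ j ≤
        θ⁻¹ / (1 - θ) * ‖FourSquares.invAbar f‖ * Real.exp (-(|Real.log θ| / 8 * n)) := by
      intro j hj
      have hlog : Real.log θ < 0 := Real.log_neg hθ0 hθ1
      have h1 : θ ^ (j + 1) ≤ Real.exp (-(|Real.log θ| / 8 * n)) := by
        rw [← Real.exp_log (pow_pos hθ0 _), Real.log_pow, Real.exp_le_exp, abs_of_neg hlog]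
        push_cast
        nlinarith
      have h2 : θ ^ j = θ⁻¹ * θ ^ (j + 1) := by
        rw [pow_succ]
        field_simp
      have h3 : 0 < 1 - θ := by linarith
      calc ‖FourSquares.invAbar f‖ / (1 - θ) * θ ^ j
          = θ⁻¹ / (1 - θ) * ‖FourSquares.invAbar f‖ * θ ^ (j + 1) := by rw [h2]; ring
        _ ≤ _ := by gcongr
    -- Below five dimensions the zero subspace suffices, with j = 0, since n/8 ≤ 1.
    rcases lt_or_ge n 5 with hn | hn
    · refine FourSquares.kolmogorovWidth_le ⊥ (by simp) ?_
      rintro _ ⟨y, hy, rfl⟩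
      refine ⟨0, Submodule.zero_mem _, ?_⟩
      rw [sub_zero]
      have hn' : (n : ℝ) ≤ 4 := by exact_mod_cast (by omega : n ≤ 4)
      have h1 := hexp 0 (by push_cast; linarith)
      rw [pow_zero, mul_one] at h1
      exact (FourSquares.norm_solution_le hθ0 hθ1 f hy).trans h1
    -- k is the largest order with 8k + 5 ≤ n. The error is of order θ^{k+1}, and n/8 ≤ k + 2 as
    -- `hexp` requires for j = k + 1.
    · obtain ⟨k, r, hr, rfl⟩ : ∃ k r, r < 8 ∧ n = 8 * k + 5 + r :=
        ⟨(n - 5) / 8, (n - 5) % 8, Nat.mod_lt _ (by norm_num), by omega⟩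
      obtain ⟨v, φ, -, h2⟩ :=
        FourSquares.exists_representation hθ0.ne' (FourSquares.invAbar f) k
      have hfin : Module.finrank ℝ (Submodule.span ℝ (Set.range v)) ≤ 8 * k + 5 + r :=
        (finrank_range_le_card v).trans (by simp)
      have : FiniteDimensional ℝ (Submodule.span ℝ (Set.range v)) :=
        FiniteDimensional.span_of_finite ℝ (Set.finite_range v)
      refine FourSquares.kolmogorovWidth_le _ hfin ?_
      rintro _ ⟨y, hy, rfl⟩
      refine ⟨∑ m ∈ Finset.range (k + 1), (FourSquares.paramOp θ y ^ m) (FourSquares.invAbar f),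
        ?_, ?_⟩
      · rw [h2]
        exact Submodule.sum_mem _ fun l _ => Submodule.smul_mem _ _ (Submodule.subset_span ⟨l, rfl⟩)
      · refine (FourSquares.norm_solution_sub_sum_le hθ0 hθ1 f hy (k + 1)).trans (hexp (k + 1) ?_)
        have hr' : (r : ℝ) ≤ 8 := by exact_mod_cast hr.le
        push_cast
        linarith
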